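/- Let $L\ge 2$ be a constant and let $(a_1,\dots,a_L)$ be a fixed vector of integers with $a_1\ge a_2\ge\dots\ge a_L\ge 0$ and $a_2=a_3=\dots=a_L$. Let $M$ be a finite set of candidates. An up-to-$L$ vote is a ranking of $\ell$ distinct candidates of $M$ for some $1\le \ell\le L$. Under down-rounding positional scoring, the candidate ranked $j$-th in a vote that ranks $\ell$ candidates gets $a_{L-\ell+j}$ points from this vote, and an unranked candidate gets $0$ points. The winner of a profile (a finite list) of votes is the candidate with the largest total score, ties being broken by a given linear priority order on the candidates. Consider the following decision problem. Input: the set $M$ of $m$ candidates, listed in the order of tie-breaking priority, a profile $P$ of $n$ known up-to-$L$ votes, the number $t\ge 0$ of absent votes, and a candidate $c\in M$. Question: is there a profile $P'$ of exactly $t$ up-to-$L$ votes such that $c$ is the winner of the combined profile $P\cup P'$? This problem can be decided by a Turing machine in time polynomial in the size of the input, where $t$ is encoded in unary; that is, in time polynomial in $m$, $n$ and $t$. -/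

import Mathlib

/-- Up-to-`L` rankings of the candidates `0, …, m - 1`: lists, without repetition, of at least one
and at most `L` candidates, the most preferred candidate first. -/
def UpToVote (L m : ℕ) : Type :=
  {R : List (Fin m) // R.Nodup ∧ 1 ≤ R.length ∧ R.length ≤ L}

namespace UpToVote

variable {L m : ℕ}

theorem position_lt (V : UpToVote L m) {x : Fin m} (hx : x ∈ V.1) :
    L - V.1.length + V.1.idxOf x < L := by
  have h1 := List.idxOf_lt_length_of_mem hx
  have h2 := V.2.2.2
  omega

/-- The down-rounding score of candidate `x` in the vote `V` for the scoring vector `a`: with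
1-based indices, the `j`-th candidate of an `ℓ`-ranking gets `a_{L - ℓ + j}`; a candidate that is
not ranked gets `0`. (The indices of `Fin L` and of `List.idxOf` start at `0`.) -/
def downScore (a : Fin L → ℕ) (V : UpToVote L m) (x : Fin m) : ℕ :=
  if hx : x ∈ V.1 then a ⟨L - V.1.length + V.1.idxOf x, V.position_lt hx⟩ else 0

end UpToVote

section Rule

variable {L m : ℕ}

/-- The total score of candidate `x` in the profile `P`. -/
def profileScore (a : Fin L → ℕ) (P : List (UpToVote L m)) (x : Fin m) : ℕ :=
  (P.map fun V => V.downScore a x).sum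

/-- The candidates of maximal total score. -/
def topScorers (a : Fin L → ℕ) (P : List (UpToVote L m)) : Finset (Fin m) :=
  {x | ∀ y, profileScore a P y ≤ profileScore a P x}

theorem topScorers_nonempty [Nonempty (Fin m)] (a : Fin L → ℕ) (P : List (UpToVote L m)) :
    (topScorers a P).Nonempty := by
  obtain ⟨x, hx⟩ := Finite.exists_max (profileScore a P)
  exact ⟨x, by simpa [topScorers] using hx⟩

/-- The winner under the down-rounding positional scoring rule: among the candidates of maximal
score the one with the highest tie-breaking priority. Candidates are numbered in the order of the
tie-breaking priority, candidate `0` having the highest priority. -/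
def downWinner [Nonempty (Fin m)] (a : Fin L → ℕ) (P : List (UpToVote L m)) : Fin m :=
  (topScorers a P).min' (topScorers_nonempty a P)

end Rule

/-- An input of the problem "winner with absent votes" in the up-to-`L` setting. -/
structure WAVInstance (L : ℕ) where
  /-- the number of candidates; the candidates are `0, …, numCandidates - 1`, listed by
  tie-breaking priority -/
  numCandidates : ℕ
  /-- the profile of the known votes -/
  known : List (UpToVote L numCandidates)
  /-- the number of absent votes -/
  numAbsent : ℕ
  /-- the target candidate -/
  target : Fin numCandidates

namespace WAVInstance

variable {L : ℕ}

/-- The question: can the absent votes be cast such that the target candidate wins? -/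
def IsYes (a : Fin L → ℕ) (I : WAVInstance L) : Prop :=
  haveI : Nonempty (Fin I.numCandidates) := ⟨I.target⟩
  ∃ P' : List (UpToVote L I.numCandidates),
    P'.length = I.numAbsent ∧ downWinner a (I.known ++ P') = I.target

open Computability in
/-- A number in unary. -/
def encodeUnary (n : ℕ) : List Γ' :=
  List.replicate n (Γ'.bit true)

open Computability in
/-- A vote as a bracketed list of candidates. -/
def encodeVote {m : ℕ} (V : UpToVote L m) : List Γ' :=
  Γ'.bra :: (V.1.flatMap fun x => encodeUnary x.val ++ [Γ'.comma]) ++ [Γ'.ket]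

open Computability in
/-- The encoding of an input as a string. Its length is at least the number of candidates, of known
votes and of absent votes, and for fixed `L` it is polynomially bounded in these three numbers. -/
def encode (I : WAVInstance L) : List Γ' :=
  encodeUnary I.numCandidates ++ Γ'.comma ::
    (encodeUnary I.numAbsent ++ Γ'.comma ::
      (encodeUnary I.target.val ++ Γ'.comma :: I.known.flatMap encodeVote))

end WAVInstance

/-- The decision problem `Q` on inputs of type `α`, encoded as strings by `enc`, is decided by a
(multi-stack) Turing machine in time polynomial in the length of the encoded input. -/
def DecidableInPolyTime {α Γ : Type} (enc : α → List Γ) (Q : α → Prop) : Prop :=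
  ∃ f : α → Bool, (∀ x, f x = true ↔ Q x) ∧
    Nonempty (Turing.TM2ComputableInPolyTime enc Computability.encodeBool f)

/-! Put b = a_2 = … = a_L and d = a_1 − a_2. Under down-rounding every ranked candidate gets b, and
only the head of a ranking of full length L gets d more. Hence an absent vote serves the target c
best in one of two forms: c alone (b for c, nothing for rivals), or a complete ranking headed by c
(d more for c, at the price of b for each of L − 1 rivals). If k votes have the second form, c ends
with s(c) + tb + kd, and a rival y may occur in j of them as long as the inequality `Fits` holds; it
must hold at least for j = 0. It remains to choose k sets of L − 1 rivals such that each y lies in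
at most r(y) ≤ k of them, which is possible as soon as the r(y) sum to at least k(L − 1)
(`exists_finsets_card_filter_mem_le`). Conversely, the complete votes headed by c in any winning
completion yield the same inequalities. So c can win iff some k ≤ t passes the count `Feasible`
(`isYes_of_feasible`, `feasible_of_isYes`).

The criterion is tested by brute force over k, y and j, all bounded by the length of the unary
input. The test is written as a `LoopProgram`, whose loops run over the input word, so that
polynomial time comes for free: `exists_reachesIn_code` simulates any program on a stack machine
within the polynomial `cost`, with the sum of the registers as potential, and `decidableInPolyTime`
adds input and output. `run_program` shows that the program tests `Feasible`. -/

open Turing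

/-! ### Loop programs and their cost -/

/-- Programs over registers `R` holding natural numbers, which read an input word over `Γ`. The
only loops are `forIn`, which runs its body once for every symbol of the input word, and `drain`. -/
inductive LoopProgram (Γ R : Type) : Type
  | skip
  | inc (r : R)
  | dec (r : R)
  /-- subtract the contents of `r` from `t`, and clear `r` -/
  | drain (r t : R)
  | seq (p q : LoopProgram Γ R)
  /-- run `p` if the register `r` is zero, and `q` otherwise -/
  | ifz (r : R) (p q : LoopProgram Γ R)
  | forIn (body : Γ → LoopProgram Γ R)

namespace LoopProgram

variable {Γ R : Type}

/-- The register contents after running a program on the input word `w`. -/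
def run [DecidableEq R] (w : List Γ) : LoopProgram Γ R → (R → ℕ) → R → ℕ
  | skip, s => s
  | inc r, s => Function.update s r (s r + 1)
  | dec r, s => Function.update s r (s r - 1)
  | drain r t, s => Function.update (Function.update s t (s t - s r)) r 0
  | seq p q, s => q.run w (p.run w s)
  | ifz r p q, s => if s r = 0 then p.run w s else q.run w s
  | forIn body, s => w.foldl (fun s x => (body x).run w s) s

/-- The nesting depth of the loops over the input word. -/
def depth [Fintype Γ] : LoopProgram Γ R → ℕ
  | skip | inc _ | dec _ | drain _ _ => 0
  | seq p q | ifz _ p q => max p.depth q.depth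
  | forIn body => (Finset.univ.sup fun x => (body x).depth) + 1

/-- A bound on the amortized running time, as a polynomial in the length of the input word. -/
noncomputable def cost [Fintype Γ] : LoopProgram Γ R → Polynomial ℕ
  -- The rounds of `drain` are paid by the potential they remove; only its final test is charged.
  | skip | dec _ | drain _ _ => 1
  -- One step, and one unit of potential for the new mark.
  | inc _ => 2
  | seq p q => p.cost + q.cost
  | ifz _ p q => 1 + p.cost + q.cost
  -- Each symbol is moved to the spool and back, besides the body; two more steps find the stacks
  -- empty.
  | forIn body => Polynomial.X * (∑ x, (body x).cost + 2) + 2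

/-! ### Compilation to stack machine code -/

/-- The labels of the Turing machine code of a program. -/
def Label : LoopProgram Γ R → Type
  | skip | inc _ | dec _ | drain _ _ => Unit
  | seq p q => p.Label ⊕ q.Label
  | ifz _ p q => Option (p.Label ⊕ q.Label)
  | forIn body => Bool ⊕ (Σ x, (body x).Label)

/-- The label at which the code of a program is entered. -/
def entry : (p : LoopProgram Γ R) → p.Label
  | skip | inc _ | dec _ | drain _ _ => ()
  | seq p _ => Sum.inl p.entry
  | ifz _ _ _ => none
  | forIn _ => Sum.inl false

/-- There are finitely many labels. -/
@[reducible]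
def fintypeLabel [Fintype Γ] : (p : LoopProgram Γ R) → Fintype p.Label
  | skip | inc _ | dec _ | drain _ _ => inferInstanceAs (Fintype Unit)
  | seq p q =>
    haveI := p.fintypeLabel
    haveI := q.fintypeLabel
    inferInstanceAs (Fintype (p.Label ⊕ q.Label))
  | ifz _ p q =>
    haveI := p.fintypeLabel
    haveI := q.fintypeLabel
    inferInstanceAs (Fintype (Option (p.Label ⊕ q.Label)))
  | forIn body =>
    haveI := fun x => (body x).fintypeLabel
    inferInstanceAs (Fintype (Bool ⊕ (Σ x, (body x).Label)))

/-- The stacks of the machine over the alphabet `Γ`: the input, the registers in unary, and for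
every loop level `i : ι` the symbols to be read and the symbols already read. -/
inductive Stack (R ι : Type) : Type
  | input
  | reg (r : R)
  | loop (i : ι)
  | spool (i : ι)
  deriving DecidableEq, Fintype

/-- The stack alphabets; the stack `none` is the output. -/
abbrev Alphabet (Γ R ι : Type) : Option (Stack R ι) → Type
  | none => Bool
  | some _ => Γ

section Code

variable {ι Λ : Type} [Inhabited Γ]

/-- The machine code of a program which is embedded into a machine by `emb`, jumps to `exit` in the
end, and uses the loop level `e j` for loops of depth `j + 1`. -/
def code [Fintype Γ] (e : ℕ → ι) : (p : LoopProgram Γ R) → (p.Label → Λ) → Λ → p.Label →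
    TM2.Stmt (Alphabet Γ R ι) Λ (Option Γ)
  | skip, _, exit, _ => .goto fun _ => exit
  | inc r, _, exit, _ => .push (some (.reg r)) (fun _ => default) (.goto fun _ => exit)
  | dec r, _, exit, _ => .pop (some (.reg r)) (fun v _ => v) (.goto fun _ => exit)
  | drain r t, emb, exit, _ =>
    .pop (some (.reg r)) (fun _ o => o) (.branch Option.isSome
      (.pop (some (.reg t)) (fun v _ => v) (.goto fun _ => emb ())) (.goto fun _ => exit))
  | seq p q, emb, exit, l =>
    match l with
    | .inl l => p.code e (fun l => emb (.inl l)) (emb (.inr q.entry)) l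
    | .inr l => q.code e (fun l => emb (.inr l)) exit l
  | ifz r p q, emb, exit, l =>
    match l with
    | none => .peek (some (.reg r)) (fun _ o => o) (.branch Option.isSome
        (.goto fun _ => emb (some (.inr q.entry))) (.goto fun _ => emb (some (.inl p.entry))))
    | some (.inl l) => p.code e (fun l => emb (some (.inl l))) exit l
    | some (.inr l) => q.code e (fun l => emb (some (.inr l))) exit l
  | forIn body, emb, exit, l =>
    let i := e (Finset.univ.sup fun x => (body x).depth)
    match l with
    | .inl false => .pop (some (.loop i)) (fun _ o => o) (.branch Option.isSome
        (.push (some (.spool i)) (fun v => v.getD default)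
          (.goto fun v => emb (.inr ⟨v.getD default, (body (v.getD default)).entry⟩)))
        (.goto fun _ => emb (.inl true)))
    -- The spool is poured back, so the word is intact when the loop is entered again.
    | .inl true => .pop (some (.spool i)) (fun _ o => o) (.branch Option.isSome
        (.push (some (.loop i)) (fun v => v.getD default) (.goto fun _ => emb (.inl true)))
        (.goto fun _ => exit))
    | .inr ⟨x, l⟩ => (body x).code e (fun l => emb (.inr ⟨x, l⟩)) (emb (.inl false)) l

/-- The stack contents for given register contents and loop contents. -/
def contents (inp : List Γ) (s : R → ℕ) (lp sp : ι → List Γ) :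
    (k : Option (Stack R ι)) → List (Alphabet Γ R ι k)
  | none => []
  | some .input => inp
  | some (.reg r) => List.replicate (s r) default
  | some (.loop i) => lp i
  | some (.spool i) => sp i

variable [DecidableEq R] [DecidableEq ι]

theorem update_contents_input (inp inp' : List Γ) (s : R → ℕ) (lp sp : ι → List Γ) :
    Function.update (contents inp s lp sp) (some .input) inp' = contents inp' s lp sp := by
  funext k
  rcases k with _ | _ | r | i | i <;> simp [contents]

theorem update_contents_reg (inp : List Γ) (s : R → ℕ) (lp sp : ι → List Γ) (r : R) (n : ℕ) :
    Function.update (contents inp s lp sp) (some (.reg r)) (List.replicate n default) =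
      contents inp (Function.update s r n) lp sp := by
  funext k
  rcases k with _ | _ | t | i | i
  case some.reg =>
    by_cases h : t = r
    · subst h; simp [contents]
    · simp [contents, Function.update_of_ne, h]
  all_goals simp [contents]

theorem update_contents_loop (inp : List Γ) (s : R → ℕ) (lp sp : ι → List Γ) (i : ι) (u : List Γ) :
    Function.update (contents inp s lp sp) (some (.loop i)) u =
      contents inp s (Function.update lp i u) sp := by
  funext k
  rcases k with _ | _ | t | j | j
  case some.loop =>
    by_cases h : j = i
    · subst h; simp [contents]
    · simp [contents, Function.update_of_ne, h]
  all_goals simp [contents]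

theorem update_contents_spool (inp : List Γ) (s : R → ℕ) (lp sp : ι → List Γ) (i : ι) (u : List Γ) :
    Function.update (contents inp s lp sp) (some (.spool i)) u =
      contents inp s lp (Function.update sp i u) := by
  funext k
  rcases k with _ | _ | t | j | j
  case some.spool =>
    by_cases h : j = i
    · subst h; simp [contents]
    · simp [contents, Function.update_of_ne, h]
  all_goals simp [contents]

/-! ### Simulation and amortized running time -/

/-- Configuration `b` is reached from configuration `a` in exactly `n` steps. -/
def ReachesIn {σ : Type} (f : σ → Option σ) (n : ℕ) (a b : σ) : Prop :=
  (flip bind f)^[n] (some a) = some b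

theorem ReachesIn.single {σ : Type} {f : σ → Option σ} {a b : σ} (h : f a = some b) :
    ReachesIn f 1 a b := h

theorem ReachesIn.trans {σ : Type} {f : σ → Option σ} {m n : ℕ} {a b c : σ}
    (h₁ : ReachesIn f m a b) (h₂ : ReachesIn f n b c) : ReachesIn f (m + n) a c := by
  unfold ReachesIn at *
  rw [Nat.add_comm, Function.iterate_add_apply, h₁, h₂]

theorem sum_update_le [Fintype R] (s : R → ℕ) (r : R) (n k : ℕ) (h : n ≤ s r + k) :
    ∑ t, Function.update s r n t ≤ ∑ t, s t + k := by
  rw [Finset.sum_update_of_mem (Finset.mem_univ r), ← Finset.add_sum_erase _ s (Finset.mem_univ r),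
    Finset.sdiff_singleton_eq_erase]
  omega

theorem sum_update_dec [Fintype R] (s : R → ℕ) (r : R) (h : s r ≠ 0) :
    ∑ t, Function.update s r (s r - 1) t + 1 = ∑ t, s t := by
  rw [Finset.sum_update_of_mem (Finset.mem_univ r), ← Finset.add_sum_erase _ s (Finset.mem_univ r),
    Finset.sdiff_singleton_eq_erase]
  omega

/-- The loop that pops two stacks in parallel drains a register, in amortized constant time. -/
theorem exists_reachesIn_drain [Fintype R] (M : Λ → TM2.Stmt (Alphabet Γ R ι) Λ (Option Γ))
    (r t : R) (l exit : Λ)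
    (hM : M l = .pop (some (.reg r)) (fun _ o => o) (.branch Option.isSome
      (.pop (some (.reg t)) (fun v _ => v) (.goto fun _ => l)) (.goto fun _ => exit)))
    (w inp : List Γ) (lp sp : ι → List Γ) (n : ℕ) :
    ∀ (s : R → ℕ) (v : Option Γ), s r = n → ∃ k v', ReachesIn (TM2.step M) k
      ⟨some l, v, contents inp s lp sp⟩
      ⟨some exit, v', contents inp ((drain r t : LoopProgram Γ R).run w s) lp sp⟩ ∧
      k + ∑ x, (drain r t : LoopProgram Γ R).run w s x ≤ 1 + ∑ x, s x := by
  induction n using Nat.strong_induction_on with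
  | _ n ih =>
    intro s v hn
    obtain hn0 | hn0 := Nat.eq_zero_or_pos n
    · refine ⟨1, none, ReachesIn.single ?_, ?_⟩
      · have : Function.update s r 0 = s := by rw [← hn0, ← hn]; simp
        simp [hM, contents, hn, hn0, run, this]
      · have : Function.update s r 0 = s := by rw [← hn0, ← hn]; simp
        simp [run, hn, hn0, this]
    -- One round pops both registers. For `r = t` the same register is popped twice, which still
    -- ends at zero; this is how registers are cleared.
    · set s₁ := Function.update s r (s r - 1) with hs₁
      set s₂ := Function.update s₁ t (s₁ t - 1) with hs₂
      have hlt : s₂ r < n := by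
        obtain rfl | htr := eq_or_ne r t
        · simp [hs₂, hs₁]; omega
        · simp [hs₂, hs₁, htr]; omega
      have hrun : (drain r t : LoopProgram Γ R).run w s = (drain r t : LoopProgram Γ R).run w s₂ := by
        funext x
        obtain rfl | htr := eq_or_ne r t
        · simp [run, hs₂, hs₁]
        · simp only [run, hs₂, hs₁, Function.update_apply, htr, htr.symm, if_true, if_false]
          split_ifs <;> first | rfl | omega
      obtain ⟨k, v', hk, hsum⟩ := ih _ hlt s₂ (some default) rfl
      refine ⟨1 + k, v', ReachesIn.trans (ReachesIn.single ?_) (hrun ▸ hk), ?_⟩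
      · have h1 : (contents inp s lp sp (some (.reg r)) : List Γ) = List.replicate (s r) default := rfl
        have h2 : (contents inp s₁ lp sp (some (.reg t)) : List Γ) = List.replicate (s₁ t) default := rfl
        simp only [TM2.step, hM, TM2.stepAux]
        rw [h1, List.tail_replicate, update_contents_reg, ← hs₁, h2, List.tail_replicate,
          update_contents_reg, ← hs₂, List.head?_replicate, if_neg (by omega)]
        rfl
      · rw [hrun]
        -- The pop of `r` lowers the potential by one and thereby pays for the round.
        have h1 := sum_update_dec s r (by omega)
        have h2 := sum_update_le s₁ t (s₁ t - 1) 0 (by omega)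
        rw [← hs₁] at h1
        rw [← hs₂] at h2
        omega

theorem step_zero_test (M : Λ → TM2.Stmt (Alphabet Γ R ι) Λ (Option Γ)) (r : R) (l l₁ l₂ : Λ)
    (hM : M l = .peek (some (.reg r)) (fun _ o => o) (.branch Option.isSome
        (.goto fun _ => l₂) (.goto fun _ => l₁)))
    (inp : List Γ) (s : R → ℕ) (lp sp : ι → List Γ) (v : Option Γ) :
    TM2.step M ⟨some l, v, contents inp s lp sp⟩ =
      some (if s r = 0 then ⟨some l₁, none, contents inp s lp sp⟩ else
        ⟨some l₂, some default, contents inp s lp sp⟩) := by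
  have h1 : (contents inp s lp sp (some (.reg r)) : List Γ) = List.replicate (s r) default := rfl
  simp only [TM2.step, hM, TM2.stepAux, h1, List.head?_replicate]
  split_ifs <;> rfl

section Loop

variable (M : Λ → TM2.Stmt (Alphabet Γ R ι) Λ (Option Γ)) (i : ι) (l l' : Λ) (f : Γ → Λ)
    (hM : M l = .pop (some (.loop i)) (fun _ o => o) (.branch Option.isSome
        (.push (some (.spool i)) (fun v => v.getD default) (.goto fun v => f (v.getD default)))
        (.goto fun _ => l')))
    (inp : List Γ) (s : R → ℕ) (lp sp : ι → List Γ) (v : Option Γ)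

include hM

theorem step_loop_nil (u' : List Γ) :
    TM2.step M ⟨some l, v, contents inp s (Function.update lp i []) (Function.update sp i u')⟩ =
      some ⟨some l', none, contents inp s (Function.update lp i []) (Function.update sp i u')⟩ := by
  simp [hM, contents, update_contents_loop]

theorem step_loop_cons (x : Γ) (u u' : List Γ) :
    TM2.step M ⟨some l, v,
        contents inp s (Function.update lp i (x :: u)) (Function.update sp i u')⟩ =
      some ⟨some (f x), some x,
        contents inp s (Function.update lp i u) (Function.update sp i (x :: u'))⟩ := by
  simp [hM, contents, update_contents_loop, update_contents_spool]

end Loop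

omit [Inhabited Γ] [DecidableEq R] in
theorem depth_le_sup [Fintype Γ] (body : Γ → LoopProgram Γ R) (x : Γ) :
    (body x).depth ≤ Finset.univ.sup fun x => (body x).depth :=
  Finset.le_sup (f := fun x => (body x).depth) (Finset.mem_univ x)

/-- Pouring the spool back undoes the reversal made while the word was read. -/
theorem exists_reachesIn_unspool (M : Λ → TM2.Stmt (Alphabet Γ R ι) Λ (Option Γ))
    (i : ι) (l exit : Λ)
    (hM : M l = .pop (some (.spool i)) (fun _ o => o) (.branch Option.isSome
        (.push (some (.loop i)) (fun v => v.getD default) (.goto fun _ => l))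
        (.goto fun _ => exit)))
    (inp : List Γ) (s : R → ℕ) (lp sp : ι → List Γ) (u : List Γ) :
    ∀ (u' : List Γ) (v : Option Γ), ∃ v', ReachesIn (TM2.step M) (u.length + 1)
      ⟨some l, v, contents inp s (Function.update lp i u') (Function.update sp i u)⟩
      ⟨some exit, v', contents inp s (Function.update lp i (u.reverse ++ u'))
        (Function.update sp i [])⟩ := by
  induction u with
  | nil =>
    intro u' v
    refine ⟨none, ReachesIn.single ?_⟩
    simp [hM, contents, update_contents_spool]
  | cons x u ih =>
    intro u' v
    obtain ⟨v', h⟩ := ih (x :: u') (some x)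
    refine ⟨v', ?_⟩
    rw [List.length_cons, Nat.add_comm _ 1]
    refine ReachesIn.trans (ReachesIn.single ?_) (b := ⟨some l, some x, contents inp s
      (Function.update lp i (x :: u')) (Function.update sp i u)⟩) (by simpa using h)
    simp [hM, contents, update_contents_spool, update_contents_loop]

/-- The machine code of a program simulates it, and takes amortized polynomial time, where the
potential is the sum of the registers. -/
theorem exists_reachesIn_code [Fintype Γ] [Fintype R] (e : ℕ → ι)
    (M : Λ → TM2.Stmt (Alphabet Γ R ι) Λ (Option Γ)) (w inp : List Γ) (p : LoopProgram Γ R) :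
    ∀ (emb : p.Label → Λ) (exit : Λ), (∀ l, M (emb l) = p.code e emb exit l) →
    Set.InjOn e (Set.Iio p.depth) →
    ∀ (s : R → ℕ) (lp sp : ι → List Γ) (v : Option Γ),
    (∀ j < p.depth, lp (e j) = w ∧ sp (e j) = []) →
    ∃ n v', ReachesIn (TM2.step M) n
      ⟨some (emb p.entry), v, contents inp s lp sp⟩
      ⟨some exit, v', contents inp (p.run w s) lp sp⟩ ∧
      n + ∑ x, p.run w s x ≤ p.cost.eval w.length + ∑ x, s x := by
  induction p with
  | skip =>
    intro emb exit hM _ s lp sp v _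
    refine ⟨1, v, ReachesIn.single ?_, ?_⟩
    · simp [hM, code, run]
    · simp [run, cost]
  | inc r =>
    intro emb exit hM _ s lp sp v _
    refine ⟨1, v, ReachesIn.single ?_, ?_⟩
    · simp only [TM2.step, hM, code, TM2.stepAux, run]
      rw [← update_contents_reg, List.replicate_succ]
      rfl
    · have := sum_update_le s r (s r + 1) 1 le_rfl
      simp [run, cost]
      omega
  | dec r =>
    intro emb exit hM _ s lp sp v _
    refine ⟨1, v, ReachesIn.single ?_, ?_⟩
    · simp only [TM2.step, hM, code, TM2.stepAux, run]
      rw [← update_contents_reg, ← List.tail_replicate]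
      rfl
    · have := sum_update_le s r (s r - 1) 0 (by omega)
      simp [run, cost]
      omega
  | drain r t =>
    intro emb exit hM _ s lp sp v _
    obtain ⟨n, v', h, hn⟩ := exists_reachesIn_drain M r t (emb ()) exit (hM ()) w inp lp sp _ s v rfl
    exact ⟨n, v', h, by simpa [cost] using hn⟩
  | seq p q ihp ihq =>
    intro emb exit hM he s lp sp v hw
    obtain ⟨n₁, v₁, h₁, hn₁⟩ := ihp (fun l => emb (.inl l)) (emb (.inr q.entry))
      (fun l => hM (.inl l)) (he.mono (Set.Iio_subset_Iio (le_max_left _ _))) s lp sp v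
      (fun j hj => hw j (hj.trans_le (le_max_left _ _)))
    obtain ⟨n₂, v₂, h₂, hn₂⟩ := ihq (fun l => emb (.inr l)) exit
      (fun l => hM (.inr l)) (he.mono (Set.Iio_subset_Iio (le_max_right _ _))) (p.run w s) lp sp v₁
      (fun j hj => hw j (hj.trans_le (le_max_right _ _)))
    refine ⟨n₁ + n₂, v₂, h₁.trans h₂, ?_⟩
    simp only [run, cost, Polynomial.eval_add]
    omega
  | ifz r p q ihp ihq =>
    intro emb exit hM he s lp sp v hw
    have hstep := step_zero_test M r _ _ _ (hM none) inp s lp sp v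
    by_cases hr : s r = 0
    · obtain ⟨n₁, v₁, h₁, hn₁⟩ := ihp (fun l => emb (some (.inl l))) exit
        (fun l => hM (some (.inl l))) (he.mono (Set.Iio_subset_Iio (le_max_left _ _))) s lp sp none
        (fun j hj => hw j (hj.trans_le (le_max_left _ _)))
      rw [if_pos hr] at hstep
      refine ⟨1 + n₁, v₁, (ReachesIn.single hstep).trans ?_, ?_⟩
      · simpa only [run, hr, if_true] using h₁
      · simp only [run, hr, if_true, cost, Polynomial.eval_add, Polynomial.eval_one]
        omega
    · obtain ⟨n₁, v₁, h₁, hn₁⟩ := ihq (fun l => emb (some (.inr l))) exit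
        (fun l => hM (some (.inr l))) (he.mono (Set.Iio_subset_Iio (le_max_right _ _))) s lp sp
        (some default) (fun j hj => hw j (hj.trans_le (le_max_right _ _)))
      rw [if_neg hr] at hstep
      refine ⟨1 + n₁, v₁, (ReachesIn.single hstep).trans ?_, ?_⟩
      · simpa only [run, hr, if_false] using h₁
      · simp only [run, hr, if_false, cost, Polynomial.eval_add, Polynomial.eval_one]
        omega
  | forIn body ih =>
    intro emb exit hM he s lp sp v hw
    set d := Finset.univ.sup fun x => (body x).depth with hd
    -- Loops inside the body use levels below `d`, so they never touch the half-read word of this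
    -- loop.
    have hid : ∀ j < d, e j ≠ e d := fun j hj h =>
      hj.ne (he (Set.mem_Iio.2 (Nat.lt_succ_of_lt hj)) (Set.mem_Iio.2 (Nat.lt_succ_self d)) h)
    -- Invariant: `u` is still to be read, `u'` is the spool. The cost of one body is bounded by the
    -- sum over all symbols.
    have hloop : ∀ (u u' : List Γ) (s : R → ℕ) (v : Option Γ), ∃ n v', ReachesIn (TM2.step M) n
        ⟨some (emb (.inl false)), v,
          contents inp s (Function.update lp (e d) u) (Function.update sp (e d) u')⟩
        ⟨some (emb (.inl true)), v',
          contents inp (u.foldl (fun s x => (body x).run w s) s)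
          (Function.update lp (e d) []) (Function.update sp (e d) (u.reverse ++ u'))⟩ ∧
        n + ∑ x, u.foldl (fun s x => (body x).run w s) s x ≤
          u.length * (∑ x, (body x).cost.eval w.length + 1) + 1 + ∑ x, s x := by
      intro u
      induction u with
      | nil =>
        intro u' s v
        refine ⟨1, none, ReachesIn.single
          (step_loop_nil M (e d) _ _ (fun x => emb (.inr ⟨x, (body x).entry⟩)) (hM (.inl false)) inp s lp sp v u'), by simp⟩
      | cons x u ihu =>
        intro u' s v
        obtain ⟨n₁, v₁, h₁, hn₁⟩ := ih x (fun l => emb (.inr ⟨x, l⟩)) (emb (.inl false))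
          (fun l => hM (.inr ⟨x, l⟩))
          (he.mono (Set.Iio_subset_Iio ((depth_le_sup body x).trans (Nat.le_succ _)))) s
          (Function.update lp (e d) u) (Function.update sp (e d) (x :: u')) (some x)
          (fun j hj => by
            have hj' := hj.trans_le (depth_le_sup body x)
            rw [Function.update_of_ne (hid j hj'), Function.update_of_ne (hid j hj')]
            exact hw j (Nat.lt_succ_of_lt hj'))
        obtain ⟨n₂, v₂, h₂, hn₂⟩ := ihu (x :: u') ((body x).run w s) v₁
        refine ⟨1 + n₁ + n₂, v₂, ((ReachesIn.single (step_loop_cons M (e d) _ _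
          (fun x => emb (.inr ⟨x, (body x).entry⟩)) (hM (.inl false)) inp s lp sp v x u u')).trans
          h₁).trans ?_, ?_⟩
        · simpa using h₂
        · have hx : (body x).cost.eval w.length ≤ ∑ x, (body x).cost.eval w.length :=
            Finset.single_le_sum (f := fun x => (body x).cost.eval w.length)
              (fun _ _ => Nat.zero_le _) (Finset.mem_univ x)
          simp only [List.foldl_cons, List.length_cons, Nat.add_mul, Nat.one_mul]
          omega
    obtain ⟨n, v₁, h₁, hn⟩ := hloop w [] s v
    obtain ⟨v₂, h₂⟩ := exists_reachesIn_unspool M (e d) (emb (.inl true)) exit (hM (.inl true)) inp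
      (w.foldl (fun s x => (body x).run w s) s) lp sp w.reverse [] v₁
    have hlp : Function.update lp (e d) w = lp := by
      rw [← (hw d (Nat.lt_succ_self d)).1]; simp
    have hsp : Function.update sp (e d) [] = sp := by
      rw [← (hw d (Nat.lt_succ_self d)).2]; simp
    refine ⟨n + (w.reverse.length + 1), v₂, ?_, ?_⟩
    · rw [hlp, hsp] at h₁
      rw [List.append_nil] at h₁
      rw [List.reverse_reverse, List.append_nil, hlp, hsp] at h₂
      exact h₁.trans h₂
    · simp only [run, cost, Polynomial.eval_add, Polynomial.eval_mul, Polynomial.eval_X,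
        Polynomial.eval_finsetSum, Polynomial.eval_ofNat, List.length_reverse]
      nlinarith

end Code

end LoopProgram

/-! ### The complete machine: input, answer, clearing -/

namespace LoopProgram

section Machine

variable {Γ R ι : Type} [Inhabited Γ]

/-- The phases of the machine before and after running the program. -/
inductive Phase : Type
  | read
  | copy
  | answer
  | clear
  deriving DecidableEq

instance : Fintype Phase :=
  ⟨{.read, .copy, .answer, .clear}, by rintro (_ | _ | _ | _) <;> simp⟩

/-- The stack contents with empty stacks apart from the output. -/
def outputOnly (out : List Bool) : (k : Option (Stack R ι)) → List (Alphabet Γ R ι k)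
  | none => out
  | some _ => []

/-- Push the last symbol read to all loop stacks in `l`. -/
def pushAll {Λ : Type} (l : List ι) (q : TM2.Stmt (Alphabet Γ R ι) Λ (Option Γ)) :
    TM2.Stmt (Alphabet Γ R ι) Λ (Option Γ) :=
  l.foldr (fun i q => .push (some (.loop i)) (fun v => v.getD default) q) q

/-- Pop from all stacks in `l`, and remember one of the popped symbols, if there is any. -/
def popAll {Λ : Type} (l : List (Stack R ι)) (q : TM2.Stmt (Alphabet Γ R ι) Λ (Option Γ)) :
    TM2.Stmt (Alphabet Γ R ι) Λ (Option Γ) :=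
  l.foldr (fun k q => .pop (some k) (fun v o => v <|> o) q) q

theorem stepAux_pushAll [DecidableEq R] [DecidableEq ι] {Λ : Type} (l : List ι) (hl : l.Nodup)
    (q : TM2.Stmt (Alphabet Γ R ι) Λ (Option Γ)) (x : Γ) (inp : List Γ) (s : R → ℕ)
    (sp : ι → List Γ) : ∀ lp : ι → List Γ,
    TM2.stepAux (pushAll l q) (some x) (contents inp s lp sp) =
      TM2.stepAux q (some x) (contents inp s (fun i => if i ∈ l then x :: lp i else lp i) sp) := by
  induction l with
  | nil => intro lp; simp [pushAll]
  | cons i l ih =>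
    intro lp
    have h1 : (contents inp s lp sp (some (.loop i)) : List Γ) = lp i := rfl
    have := ih (List.nodup_cons.1 hl).2 (Function.update lp i (x :: lp i))
    simp only [pushAll, List.foldr_cons, TM2.stepAux, h1, Option.getD_some,
      update_contents_loop] at this ⊢
    rw [this]
    congr 2
    funext j
    by_cases hj : j = i
    · subst hj; simp [(List.nodup_cons.1 hl).1]
    · simp [hj]

-- The state keeps the first symbol found, so starting from `none` it stays `none` exactly when all
-- listed stacks were empty. This is the termination test of the clearing phase.
omit [Inhabited Γ] in
theorem stepAux_popAll [DecidableEq R] [DecidableEq ι] {Λ : Type}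
    (q : TM2.Stmt (Alphabet Γ R ι) Λ (Option Γ)) (l : List (Stack R ι)) :
    ∀ (v : Option Γ) (S : (k : Option (Stack R ι)) → List (Alphabet Γ R ι k)),
    ∃ v' S', TM2.stepAux (popAll l q) v S = TM2.stepAux q v' S' ∧ S' none = S none ∧
      (∀ k, (S' k).length ≤ (S k).length) ∧
      (∀ k ∈ l, (S' (some k)).length ≤ (S (some k)).length - 1) ∧
      (v' = none → v = none ∧ ∀ k ∈ l, S (some k) = []) ∧
      (v = none → (∀ k ∈ l, S (some k) = []) → v' = none) := by
  induction l with
  | nil => exact fun v S => ⟨v, S, by simp [popAll]⟩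
  | cons k l ih =>
    intro v S
    obtain ⟨v', S', h1, h2, h3, h4, h5, h6⟩ := ih (v <|> (S (some k)).head?)
      (Function.update S (some k) (S (some k)).tail)
    have hle : ∀ j, (Function.update S (some k) (S (some k)).tail j).length ≤ (S j).length := by
      intro j
      by_cases hj : j = some k
      · subst hj; simp
      · simp [hj]
    refine ⟨v', S', h1, by simpa using h2, fun j => (h3 j).trans (hle j), ?_, ?_, ?_⟩
    · intro j hj
      obtain rfl | hj := List.mem_cons.1 hj
      · simpa using h3 (some j)
      · exact (h4 j hj).trans (Nat.sub_le_sub_right (hle _) 1)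
    · intro hv
      obtain ⟨h7, h8⟩ := h5 hv
      have hk : v = none ∧ S (some k) = [] := by
        rcases v with _ | x
        · exact ⟨rfl, by simpa using h7⟩
        · simp at h7
      refine ⟨hk.1, ?_⟩
      replace hk := hk.2
      intro j hj
      obtain rfl | hj := List.mem_cons.1 hj
      · exact hk
      · have := h8 j hj
        by_cases hjk : j = k
        · subst hjk; exact hk
        · simpa [Function.update_of_ne, hjk] using this
    · intro hv hS
      apply h6
      · simp [hv, hS k]
      · intro j hj
        by_cases hjk : j = k
        · subst hjk; simp [hS j]
        · simpa [Function.update_of_ne, hjk] using hS j (List.mem_cons_of_mem _ hj)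

variable [Fintype Γ] [Fintype R] [DecidableEq R]

/-- The code of the machine which runs a program on its input, and decides whether the register
`ans` is nonzero in the end. -/
noncomputable def machineCode (p : LoopProgram Γ R) (ans : R) : p.Label ⊕ Phase →
    TM2.Stmt (Alphabet Γ R (Fin (p.depth + 1))) (p.Label ⊕ Phase) (Option Γ)
  | .inl l => p.code (Fin.ofNat (p.depth + 1)) .inl (.inr .answer) l
  | .inr .read => .pop (some .input) (fun _ o => o) (.branch Option.isSome
      (.push (some (.spool 0)) (fun v => v.getD default) (.goto fun _ => .inr .read))
      (.goto fun _ => .inr .copy))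
  | .inr .copy => .pop (some (.spool 0)) (fun _ o => o) (.branch Option.isSome
      (pushAll (List.finRange _) (.goto fun _ => .inr .copy))
      (.goto fun _ => .inl p.entry))
  | .inr .answer => .peek (some (.reg ans)) (fun _ o => o)
      (.push none Option.isSome (.load (fun _ => none) (.goto fun _ => .inr .clear)))
  | .inr .clear => popAll Finset.univ.toList (.branch Option.isSome
      (.load (fun _ => none) (.goto fun _ => .inr .clear)) .halt)

/-- The machine which runs a program on its input, and decides whether the register `ans` is nonzero
in the end. -/
noncomputable def machine (p : LoopProgram Γ R) (ans : R) : FinTM2 :=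
  haveI := p.fintypeLabel
  { K := Option (Stack R (Fin (p.depth + 1)))
    k₀ := some .input
    k₁ := none
    Γ := Alphabet Γ R (Fin (p.depth + 1))
    Λ := p.Label ⊕ Phase
    main := .inr .read
    σ := Option Γ
    initialState := none
    Γk₀Fin := inferInstanceAs (Fintype Γ)
    m := p.machineCode ans }

variable (p : LoopProgram Γ R) (ans : R)

theorem reachesIn_read (w : List Γ) : ∀ (u : List Γ) (v : Option Γ),
    ReachesIn (TM2.step (p.machineCode ans)) (w.length + 1)
      ⟨some (.inr .read), v, contents w 0 (fun _ => []) (Function.update (fun _ => []) 0 u)⟩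
      ⟨some (.inr .copy), none,
        contents [] 0 (fun _ => []) (Function.update (fun _ => []) 0 (w.reverse ++ u))⟩ := by
  induction w with
  | nil =>
    intro u v
    refine ReachesIn.single ?_
    simp [machineCode, contents, update_contents_input]
  | cons x w ih =>
    intro u v
    rw [show (x :: w).length + 1 = 1 + (w.length + 1) by simp only [List.length_cons]; omega]
    refine ReachesIn.trans (ReachesIn.single ?_) (b := ⟨some (.inr .read), some x,
      contents w 0 (fun _ => []) (Function.update (fun _ => []) 0 (x :: u))⟩)
      (by simpa using ih (x :: u) (some x))
    simp [machineCode, contents, update_contents_input, update_contents_spool]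

/-- The spool holds the reversed word; popping it reverses once more, so every loop stack receives
the word in its original order. -/
theorem reachesIn_copy (w : List Γ) : ∀ (u : List Γ) (v : Option Γ),
    ReachesIn (TM2.step (p.machineCode ans)) (w.length + 1)
      ⟨some (.inr .copy), v, contents [] 0 (fun _ => u) (Function.update (fun _ => []) 0 w)⟩
      ⟨some (.inl p.entry), none, contents [] 0 (fun _ => w.reverse ++ u) (fun _ => [])⟩ := by
  induction w with
  | nil =>
    intro u v
    refine ReachesIn.single ?_
    simp [machineCode, contents, update_contents_spool]
  | cons x w ih =>
    intro u v
    rw [show (x :: w).length + 1 = 1 + (w.length + 1) by simp only [List.length_cons]; omega]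
    refine ReachesIn.trans (ReachesIn.single ?_) (b := ⟨some (.inr .copy), some x,
      contents [] 0 (fun _ => x :: u) (Function.update (fun _ => []) 0 w)⟩)
      (by simpa using ih (x :: u) (some x))
    have h1 : ∀ sp, (contents [] (0 : R → ℕ) (fun _ => u) sp
      (some (.spool (0 : Fin (p.depth + 1)))) : List Γ) = sp 0 := fun _ => rfl
    simp only [TM2.step, machineCode, TM2.stepAux, h1, update_contents_spool, Function.update_self,
      List.head?_cons, Option.isSome_some, cond_true, List.tail_cons, Function.update_idem]
    rw [stepAux_pushAll _ (List.nodup_finRange _)]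
    simp

/-- A halting configuration has empty stacks apart from the output. Every round shortens all
nonempty stacks at once, and one last round finds them empty. -/
theorem exists_reachesIn_clear (n : ℕ) : ∀ (v : Option Γ)
    (S : (k : Option (Stack R (Fin (p.depth + 1)))) → List (Alphabet Γ R _ k)),
    v = none → (∀ k, (S (some k)).length ≤ n) → ∃ m ≤ n + 1,
      ReachesIn (TM2.step (p.machineCode ans)) m ⟨some (.inr .clear), v, S⟩
        ⟨none, none, outputOnly (S none)⟩ := by
  induction n with
  | zero =>
    intro v S hv hS
    obtain ⟨v', S', h1, h2, h3, h4, h5, h6⟩ := stepAux_popAll (Λ := p.Label ⊕ Phase)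
      (.branch Option.isSome (.load (fun _ => none) (.goto fun _ => .inr .clear)) .halt)
      Finset.univ.toList v S
    have hv' := h6 hv fun k _ => by simpa using hS k
    refine ⟨1, le_rfl, ReachesIn.single ?_⟩
    simp only [TM2.step, machineCode, h1, hv', TM2.stepAux, Option.isSome_none, cond_false]
    congr 2
    funext k
    rcases k with _ | k
    · exact h2
    · simpa [outputOnly] using (h3 (some k)).trans (hS k)
  | succ n ih =>
    intro v S hv hS
    obtain ⟨v', S', h1, h2, h3, h4, h5, h6⟩ := stepAux_popAll (Λ := p.Label ⊕ Phase)
      (.branch Option.isSome (.load (fun _ => none) (.goto fun _ => .inr .clear)) .halt)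
      Finset.univ.toList v S
    rcases v' with _ | x
    · refine ⟨1, by omega, ReachesIn.single ?_⟩
      simp only [TM2.step, machineCode, h1, TM2.stepAux, Option.isSome_none, cond_false]
      congr 2
      funext k
      rcases k with _ | k
      · exact h2
      · have := h3 (some k)
        rw [(h5 rfl).2 k (by simp)] at this
        simpa [outputOnly] using this
    · obtain ⟨m, hm, h⟩ := ih none S' rfl fun k => by
        have := h4 k (by simp)
        have := hS k
        omega
      refine ⟨1 + m, by omega, ReachesIn.trans (ReachesIn.single ?_) (h2 ▸ h)⟩
      simp only [TM2.step, machineCode, h1, TM2.stepAux, Option.isSome_some, cond_true]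

theorem initList_machine (w : List Γ) : initList (p.machine ans) w =
    ⟨some (.inr .read), none, contents w 0 (fun _ => []) (fun _ => [])⟩ := by
  unfold initList
  congr 1
  funext k
  rcases k with _ | _ | r | i | i <;> rfl

theorem haltList_machine (b : Bool) : haltList (p.machine ans) [b] =
    ⟨none, none, outputOnly [b]⟩ := by
  unfold haltList
  congr 1
  funext k
  rcases k with _ | _ | r | i | i <;> rfl

/-- A machine running a program takes polynomial time. -/
theorem exists_reachesIn_machine (w : List Γ) : ∃ n ≤ 2 * p.cost.eval w.length + 3 * w.length + 4,
    ReachesIn (p.machine ans).step n (initList (p.machine ans) w)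
      (haltList (p.machine ans) [decide (p.run w 0 ans ≠ 0)]) := by
  -- The levels in use lie below `p.depth`; the additional one ensures that level 0 exists even
  -- without loops.
  have he : Set.InjOn (Fin.ofNat (p.depth + 1)) (Set.Iio p.depth) := by
    intro i hi j hj h
    rw [Set.mem_Iio] at hi hj
    have := congrArg Fin.val h
    simpa [Fin.ofNat, Nat.mod_eq_of_lt, Nat.lt_succ_of_lt hi, Nat.lt_succ_of_lt hj] using this
  have h1 := p.reachesIn_read ans w [] none
  have h2 := p.reachesIn_copy ans w.reverse [] none
  obtain ⟨n, v, h3, hn⟩ := exists_reachesIn_code (Fin.ofNat (p.depth + 1)) (p.machineCode ans) w []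
    p .inl (.inr .answer) (fun _ => rfl) he 0 (fun _ => w) (fun _ => []) none (fun _ _ => ⟨rfl, rfl⟩)
  set s := p.run w 0 with hs
  have h4 : TM2.step (p.machineCode ans) ⟨some (.inr .answer), v,
      contents [] s (fun _ => w) (fun _ => [])⟩ = some ⟨some (.inr .clear), none, Function.update
        (contents [] s (fun _ => w) (fun _ => [])) none [decide (s ans ≠ 0)]⟩ := by
    have h1 : (contents [] s (fun _ => w) (fun _ => [])
      (some (.reg ans) : Option (Stack R (Fin (p.depth + 1)))) : List Γ) =
      List.replicate (s ans) default := rfl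
    have h2 : (contents [] s (fun _ => w) (fun _ => [])
      (none : Option (Stack R (Fin (p.depth + 1)))) : List Bool) = [] := rfl
    simp only [TM2.step, machineCode, TM2.stepAux, h1, List.head?_replicate]
    rw [h2]
    by_cases h : s ans = 0 <;> simp [h]
  -- Registers start at zero, so `hn` bounds their final sum by the cost; the loop stacks are as
  -- long as the word.
  obtain ⟨m, hm, h5⟩ := p.exists_reachesIn_clear ans (p.cost.eval w.length + w.length) none
    (Function.update (contents [] s (fun _ => w) (fun _ => [])) none [decide (s ans ≠ 0)]) rfl (by
      intro k
      rw [Function.update_of_ne (by simp)]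
      rcases k with _ | r | i | i
      · simp [contents]
      · have : s r ≤ ∑ x, s x := Finset.single_le_sum (fun _ _ => Nat.zero_le _) (Finset.mem_univ r)
        simp [contents] at hn ⊢
        omega
      · simp [contents]
      · simp [contents])
  -- The summands are reading, copying, the program, the answer and clearing.
  refine ⟨(w.length + 1) + (w.reverse.length + 1) + n + 1 + m, ?_, ?_⟩
  · simp at hn ⊢
    omega
  · rw [initList_machine, haltList_machine]
    simp only [Function.update_eq_self, List.append_nil, List.reverse_reverse] at h1 h2
    simp only [Function.update_self] at h5
    exact (((h1.trans h2).trans h3).trans (ReachesIn.single h4)).trans h5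

/-- Deciding whether a register is nonzero after running a program takes polynomial time. -/
theorem decidableInPolyTime {α : Type} (enc : α → List Γ) (Q : α → Prop)
    (h : ∀ x, p.run (enc x) 0 ans ≠ 0 ↔ Q x) : DecidableInPolyTime enc Q := by
  refine ⟨fun x => decide (p.run (enc x) 0 ans ≠ 0), fun x => by simpa using h x, ⟨?_⟩⟩
  refine
    { tm := p.machine ans
      inputAlphabet := Equiv.refl Γ
      outputAlphabet := Equiv.refl Bool
      time := 2 * p.cost + 3 * Polynomial.X + 4
      outputsFun := fun x => ?_ }
  have h1 : List.map (Equiv.refl Γ).invFun (enc x) = enc x := List.map_id _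
  have hw : ∀ w : List Γ, w = enc x → ∃ n ≤ 2 * p.cost.eval (enc x).length +
      3 * (enc x).length + 4, ReachesIn (p.machine ans).step n (initList (p.machine ans) w)
        (haltList (p.machine ans) [decide (p.run (enc x) 0 ans ≠ 0)]) := by
    rintro w rfl
    exact p.exists_reachesIn_machine ans (enc x)
  have hx := hw _ h1
  exact
    { steps := hx.choose
      evals_in_steps := hx.choose_spec.2
      steps_le_m := by simpa using hx.choose_spec.1 }

end Machine

end LoopProgram

/-! ### Sets of equal size with bounded multiplicities -/

section Combinatorics

/-- If `r x ≤ k` for all `x` and `∑ r x ≥ k * n`, there are `k` sets of size `n` such that every `x`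
belongs to at most `r x` of them. -/
theorem exists_finsets_card_filter_mem_le {ι : Type} [Fintype ι] [DecidableEq ι] (n k : ℕ) :
    ∀ r : ι → ℕ, (∀ x, r x ≤ k) → k * n ≤ ∑ x, r x →
      ∃ l : List (Finset ι), l.length = k ∧ (∀ u ∈ l, u.card = n) ∧
        ∀ x, l.countP (x ∈ ·) ≤ r x := by
  induction k with
  | zero => exact fun r _ _ => ⟨[], by simp⟩
  | succ k ih =>
    intro r hr hsum
    -- Lower `r` until the sum is exact, so that splitting off one set of size `n` leaves exactly `k
    -- * n`.
    have hexact : ∀ d, ∀ r : ι → ℕ, (k + 1) * n + d = ∑ x, r x →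
        ∃ r' : ι → ℕ, r' ≤ r ∧ ∑ x, r' x = (k + 1) * n := by
      intro d
      induction d with
      | zero => exact fun r h => ⟨r, le_rfl, h.symm⟩
      | succ d ihd =>
        intro r h
        obtain ⟨x, -, hx⟩ : ∃ x ∈ Finset.univ, r x ≠ 0 :=
          Finset.exists_ne_zero_of_sum_ne_zero (by omega)
        have hdec := LoopProgram.sum_update_dec r x hx
        obtain ⟨r', h1, h2⟩ := ihd (Function.update r x (r x - 1)) (by omega)
        refine ⟨r', h1.trans fun y => ?_, h2⟩
        by_cases hy : y = x
        · subst hy; simp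
        · simp [hy]
    obtain ⟨r', hle, hr'⟩ := hexact (∑ x, r x - (k + 1) * n) r (by omega)
    -- Elements with value `k + 1` must enter the set split off, since afterwards the bound is `k`;
    -- the exact sum leaves room for at most `n` of them.
    have hmax : (Finset.univ.filter fun x => r' x = k + 1).card ≤ n := by
      have : (Finset.univ.filter fun x => r' x = k + 1).card * (k + 1) ≤ ∑ x, r' x := by
        calc _ = ∑ x ∈ Finset.univ.filter fun x => r' x = k + 1, r' x := by
              rw [Finset.sum_congr rfl (g := fun _ => k + 1) (by simp)]; simp
          _ ≤ _ := Finset.sum_le_sum_of_subset (Finset.filter_subset _ _)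
      rw [hr', Nat.mul_comm] at this
      exact Nat.le_of_mul_le_mul_left this (Nat.succ_pos k)
    -- No value exceeds `k + 1`, so at least `n` elements are available for the set.
    have hsupp : n ≤ (Finset.univ.filter fun x => r' x ≠ 0).card := by
      have : ∑ x, r' x ≤ (Finset.univ.filter fun x => r' x ≠ 0).card * (k + 1) := by
        rw [← Finset.sum_filter_ne_zero]
        exact Finset.sum_le_card_nsmul _ _ _ fun x _ => (hle x).trans (hr x)
      rw [hr', Nat.mul_comm] at this
      exact Nat.le_of_mul_le_mul_right this (Nat.succ_pos k)
    obtain ⟨u, hu1, hu2, hu⟩ := Finset.exists_subsuperset_card_eq (s := Finset.univ.filter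
      fun x => r' x = k + 1) (t := Finset.univ.filter fun x => r' x ≠ 0) (by
        intro x hx
        simp only [Finset.mem_filter, Finset.mem_univ, true_and] at hx ⊢
        omega) hmax hsupp
    have hpos : ∀ x ∈ u, r' x ≠ 0 := fun x hx => by simpa using hu2 hx
    have hsub : ∑ x, (r' x - if x ∈ u then 1 else 0) + n = (k + 1) * n := by
      have h1 : ∑ x, (if x ∈ u then 1 else 0) = n := by simp [hu]
      rw [← hr']
      nth_rw 1 [← h1]
      rw [← Finset.sum_add_distrib]
      refine Finset.sum_congr rfl fun x _ => ?_
      have := hpos x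
      split_ifs with hx
      · have := this hx; omega
      · rfl
    obtain ⟨l, hl1, hl2, hl3⟩ := ih (fun x => r' x - if x ∈ u then 1 else 0) (by
      intro x
      have h1 : r' x ≤ k + 1 := (hle x).trans (hr x)
      by_cases hx : x ∈ u
      · simp only [hx, if_true]; omega
      · have : r' x ≠ k + 1 := fun h => hx (hu1 (by simp [h]))
        simp only [hx, if_false]; omega) (by rw [Nat.succ_mul] at hsub; omega)
    refine ⟨u :: l, by simp [hl1], by simpa [hu] using hl2, fun x => ?_⟩
    rw [List.countP_cons]
    have h1 := hl3 x
    have h2 : r' x ≤ r x := hle x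
    have h3 := hpos x
    by_cases hx : x ∈ u
    · have := h3 hx
      simp only [hx, if_true, decide_true] at h1 ⊢
      omega
    · simp only [hx, if_false, decide_false, Bool.false_eq_true] at h1 ⊢
      omega

end Combinatorics

/-! ### Flat scores and the winner -/

section Scores

variable {L m : ℕ}

/-- The score of candidate `y` in the ranking `R`, if every ranked candidate gets `b` points, and
the first candidate of a ranking of length `L` gets `d` additional points. -/
def flatScore (L b d : ℕ) (R : List ℕ) (y : ℕ) : ℕ :=
  (if y ∈ R then b else 0) + if R.head? = some y ∧ R.length = L then d else 0

/-- A ranking shorter than `L` starts beyond entry 0 of the scoring vector, the only entry that may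
differ from the others; only the head of a complete ranking reaches it. -/
theorem UpToVote.downScore_eq_flatScore (hL : 2 ≤ L) (a : Fin L → ℕ) (ha : Antitone a)
    (hflat : ∀ i j : Fin L, 1 ≤ i.val → 1 ≤ j.val → a i = a j) (V : UpToVote L m) (x : Fin m) :
    V.downScore a x = flatScore L (a ⟨1, hL⟩) (a ⟨0, by omega⟩ - a ⟨1, hL⟩) (V.1.map Fin.val) x := by
  have hmem : x.val ∈ V.1.map Fin.val ↔ x ∈ V.1 := by simp [Fin.val_inj]
  have hhead : (V.1.map Fin.val).head? = some x.val ↔ V.1.head? = some x := by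
    simp [Fin.val_inj]
  have hle : a ⟨1, hL⟩ ≤ a ⟨0, by omega⟩ := ha (Fin.mk_le_mk.2 (Nat.zero_le _))
  simp only [UpToVote.downScore, flatScore, hmem, hhead, List.length_map]
  by_cases hx : x ∈ V.1
  · simp only [hx, dite_true, if_true]
    have hlen := V.2.2.2
    have hpos := V.position_lt hx
    by_cases h : V.1.head? = some x ∧ V.1.length = L
    · obtain ⟨u, hu⟩ : ∃ u, V.1 = x :: u := by
        obtain ⟨h1, -⟩ := h
        cases hV : V.1 with
        | nil => simp [hV] at h1
        | cons z u => simp [hV] at h1; exact ⟨u, by rw [h1]⟩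
      have h0 : L - V.1.length + V.1.idxOf x = 0 := by rw [h.2, hu]; simp
      rw [if_pos h]
      simp only [h0]
      omega
    · rw [if_neg h, Nat.add_zero]
      refine hflat _ _ ?_ le_rfl
      by_contra hlt
      have hlt' : L - V.1.length + V.1.idxOf x = 0 := by simpa using hlt
      refine h ⟨?_, by omega⟩
      have h0 : V.1.idxOf x = 0 := by omega
      cases hV : V.1 with
      | nil => simp [hV] at hx
      | cons z u =>
        by_cases hz : z = x
        · simp [hz]
        · rw [hV, List.idxOf_cons_ne _ hz] at h0
          omega
  · have : ¬ (V.1.head? = some x ∧ V.1.length = L) := fun h => hx (List.mem_of_head? h.1)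
    simp [hx, this]

theorem profileScore_append (a : Fin L → ℕ) (P P' : List (UpToVote L m)) (x : Fin m) :
    profileScore a (P ++ P') x = profileScore a P x + profileScore a P' x := by
  simp [profileScore]

/-- Scores are integers, so having to beat a candidate of higher priority strictly amounts to one
extra point for that candidate. -/
theorem downWinner_eq_iff [Nonempty (Fin m)] (a : Fin L → ℕ) (P : List (UpToVote L m))
    (c : Fin m) : downWinner a P = c ↔
      ∀ y, profileScore a P y + (if y < c then 1 else 0) ≤ profileScore a P c := by
  have hmem : ∀ x, x ∈ topScorers a P ↔ ∀ y, profileScore a P y ≤ profileScore a P x := by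
    simp [topScorers]
  constructor
  · rintro rfl y
    have h1 := (hmem _).1 ((topScorers a P).min'_mem (topScorers_nonempty a P)) y
    split_ifs with hy
    · by_contra hlt
      have heq : profileScore a P y = profileScore a P (downWinner a P) :=
        le_antisymm h1 (by omega)
      have : y ∈ topScorers a P := (hmem y).2 fun z => by
        rw [heq]; exact (hmem _).1 ((topScorers a P).min'_mem (topScorers_nonempty a P)) z
      exact absurd ((topScorers a P).min'_le y this) (not_le.2 hy)
    · exact h1
  · intro h
    have hc : c ∈ topScorers a P := (hmem c).2 fun y => (Nat.le_add_right _ _).trans (h y)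
    refine le_antisymm ((topScorers a P).min'_le c hc) (le_of_not_gt fun hlt => ?_)
    have h1 := (hmem _).1 ((topScorers a P).min'_mem (topScorers_nonempty a P)) c
    have h2 := h (downWinner a P)
    rw [if_pos hlt] at h2
    have h3 : profileScore a P c ≤ profileScore a P (downWinner a P) := h1
    omega

end Scores

/-! ### The counting criterion -/

namespace WAVInstance

variable {L : ℕ}

/-- If `k` absent votes are complete rankings headed by the target candidate, and the other ones
rank the target candidate only, then candidate `y` can be ranked in `j` of the former. -/
def Fits (b d : ℕ) (s : ℕ → ℕ) (c t k y j : ℕ) : Prop :=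
  s y + (if y < c then 1 else 0) + j * b ≤ s c + t * b + k * d

instance (b d : ℕ) (s : ℕ → ℕ) (c t k y j : ℕ) : Decidable (Fits b d s c t k y j) :=
  inferInstanceAs (Decidable (_ ≤ _))

/-- The scores in the known profile. -/
def knownScore (I : WAVInstance L) (b d y : ℕ) : ℕ :=
  (I.known.map fun V => flatScore L b d (V.1.map Fin.val) y).sum

/-- A candidate counting criterion for the winner with absent votes problem. -/
def Feasible (L b d : ℕ) (s : ℕ → ℕ) (m c t : ℕ) : Prop :=
  ∃ k ≤ t, (∀ y < m, Fits b d s c t k y 0) ∧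
    k * L ≤ ∑ y ∈ Finset.range m, ((Finset.range k).filter fun j =>
      Fits b d s c t k y (j + 1)).card

/-- Take k to be the number of complete votes headed by the target in a winning completion. The
target's score is bounded above using all votes, the rivals' scores below using only these k. -/
theorem feasible_of_isYes (hL : 2 ≤ L) (a : Fin L → ℕ) (ha : Antitone a)
    (hflat : ∀ i j : Fin L, 1 ≤ i.val → 1 ≤ j.val → a i = a j) (I : WAVInstance L)
    (h : I.IsYes a) : Feasible L (a ⟨1, hL⟩) (a ⟨0, by omega⟩ - a ⟨1, hL⟩)
      (I.knownScore (a ⟨1, hL⟩) (a ⟨0, by omega⟩ - a ⟨1, hL⟩)) I.numCandidates I.target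
      I.numAbsent := by
  set b := a ⟨1, hL⟩
  set d := a ⟨0, by omega⟩ - b
  have hs : ∀ y : Fin I.numCandidates, profileScore a I.known y = I.knownScore b d y := fun y => by
    unfold profileScore knownScore
    simp only [UpToVote.downScore_eq_flatScore hL a ha hflat]
    rfl
  have : Nonempty (Fin I.numCandidates) := ⟨I.target⟩
  obtain ⟨P', hlen, hwin⟩ := h
  rw [downWinner_eq_iff] at hwin
  simp only [profileScore_append, hs] at hwin
  set full : UpToVote L I.numCandidates → Bool := fun V =>
    decide (V.1.head? = some I.target ∧ V.1.length = L) with hfull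
  have hc : ∀ Q : List (UpToVote L I.numCandidates),
      profileScore a Q I.target ≤ Q.length * b + Q.countP full * d := by
    intro Q
    induction Q with
    | nil => simp [profileScore]
    | cons V Q ih =>
      have : V.downScore a I.target ≤ b + if full V then d else 0 := by
        rw [UpToVote.downScore_eq_flatScore hL a ha hflat]
        unfold flatScore
        refine Nat.add_le_add (by split_ifs <;> simp [b]) ?_
        simp [hfull, Fin.val_inj, d, b]
      simp only [profileScore, List.map_cons, List.sum_cons, List.length_cons,
        List.countP_cons, Nat.add_mul, Nat.one_mul] at ih ⊢
      split_ifs at this ⊢ <;> omega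
  have hy : ∀ (y : Fin I.numCandidates) (Q : List (UpToVote L I.numCandidates)),
      ((Q.filter full).countP fun V => decide (y ∈ V.1)) * b ≤ profileScore a Q y := by
    intro y Q
    induction Q with
    | nil => simp
    | cons V Q ih =>
      have : (if y ∈ V.1 then b else 0) ≤ V.downScore a y := by
        rw [UpToVote.downScore_eq_flatScore hL a ha hflat]
        unfold flatScore
        simp [Fin.val_inj, b]
      simp only [profileScore, List.map_cons, List.sum_cons] at ih ⊢
      rw [List.filter_cons]
      split_ifs
      · rw [List.countP_cons, Nat.add_mul]
        split_ifs at this ⊢ <;> simp_all <;> omega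
      · omega
  -- Double counting of pairs (vote, ranked candidate).
  have hsum : ∀ Q : List (UpToVote L I.numCandidates), (∀ V ∈ Q, V.1.length = L) →
      ∑ y, (Q.countP fun V => decide (y ∈ V.1)) = Q.length * L := by
    intro Q
    induction Q with
    | nil => simp
    | cons V Q ih =>
      intro hQ
      have h1 : ∑ y, (if y ∈ V.1 then 1 else 0) = L := by
        have := List.toFinset_card_of_nodup V.2.1
        rw [hQ V (by simp)] at this
        refine Eq.trans ?_ this
        rw [← Finset.sum_filter, ← Finset.card_eq_sum_ones]
        congr 1
        ext y
        simp
      simp only [List.countP_cons, Finset.sum_add_distrib, List.length_cons, Nat.add_mul,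
        Nat.one_mul, decide_eq_true_eq, h1]
      rw [ih fun V hV => hQ V (List.mem_cons_of_mem _ hV)]
  have hfits : ∀ (y : Fin I.numCandidates) (j : ℕ),
      j ≤ (P'.filter full).countP (fun V => decide (y ∈ V.1)) →
      Fits b d (I.knownScore b d) I.target I.numAbsent (P'.countP full) y j := by
    intro y j hj
    have h1 := hwin y
    have h2 := hc P'
    have h3 := hy y P'
    have h4 := Nat.mul_le_mul_right b hj
    rw [hlen] at h2
    simp only [Fits, Fin.val_fin_lt]
    omega
  refine ⟨P'.countP full, hlen ▸ List.countP_le_length, ?_, ?_⟩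
  · intro y hym
    exact hfits ⟨y, hym⟩ 0 (Nat.zero_le _)
  · rw [List.countP_eq_length_filter,
      ← hsum _ (fun V hV => (by simpa [hfull] using List.of_mem_filter hV : _ ∧ _).2),
      Finset.sum_range]
    refine Finset.sum_le_sum fun y _ => ?_
    rw [← List.countP_eq_length_filter]
    calc (P'.filter full).countP (fun V => decide (y ∈ V.1))
        = (Finset.range ((P'.filter full).countP (fun V => decide (y ∈ V.1)))).card := by simp
      -- If `y` occurs in `n` of these votes, then each of 1, …, `n` fits; index `j` stands for `j +
      -- 1` occurrences.
      _ ≤ _ := Finset.card_le_card fun j hj => by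
        have hj' := Finset.mem_range.1 hj
        rw [Finset.mem_filter, Finset.mem_range]
        refine ⟨hj'.trans_le ?_, hfits y (j + 1) hj'⟩
        rw [List.countP_eq_length_filter (p := full)]
        exact List.countP_le_length

/-- Cast k complete votes headed by the target, with rivals placed by the combinatorial lemma, and
let all other votes rank the target alone. -/
theorem isYes_of_feasible (hL : 2 ≤ L) (a : Fin L → ℕ) (ha : Antitone a)
    (hflat : ∀ i j : Fin L, 1 ≤ i.val → 1 ≤ j.val → a i = a j) (I : WAVInstance L)
    (h : Feasible L (a ⟨1, hL⟩) (a ⟨0, by omega⟩ - a ⟨1, hL⟩)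
      (I.knownScore (a ⟨1, hL⟩) (a ⟨0, by omega⟩ - a ⟨1, hL⟩)) I.numCandidates I.target
      I.numAbsent) : I.IsYes a := by
  set b := a ⟨1, hL⟩
  set d := a ⟨0, by omega⟩ - b
  have hs : ∀ y : Fin I.numCandidates, profileScore a I.known y = I.knownScore b d y := fun y => by
    unfold profileScore knownScore
    simp only [UpToVote.downScore_eq_flatScore hL a ha hflat]
    rfl
  have : Nonempty (Fin I.numCandidates) := ⟨I.target⟩
  obtain ⟨k, hk, h0, hsum⟩ := h
  set r : Fin I.numCandidates → ℕ := fun y => ((Finset.range k).filter fun j =>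
      Fits b d (I.knownScore b d) I.target I.numAbsent k y (j + 1)).card with hr
  have hrk : ∀ y, r y ≤ k := fun y => (Finset.card_filter_le _ _).trans (by simp)
  -- `Fits` is inherited by smaller `j`, so the number of fitting values is itself a fitting value:
  -- otherwise all of them would be below `r y`, too few to be counted `r y` times.
  have hrfits : ∀ y : Fin I.numCandidates, Fits b d (I.knownScore b d) I.target I.numAbsent k y (r y) := by
    intro y
    by_contra hnot
    have h1 : r y ≠ 0 := fun h => hnot (h ▸ h0 y y.2)
    have h2 : ((Finset.range k).filter fun j =>
        Fits b d (I.knownScore b d) I.target I.numAbsent k y (j + 1)) ⊆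
        Finset.range (r y - 1) := by
      intro j hj
      rw [Finset.mem_filter] at hj
      rw [Finset.mem_range]
      by_contra hlt
      refine hnot (le_trans ?_ hj.2)
      have : r y * b ≤ (j + 1) * b := Nat.mul_le_mul_right b (by omega)
      omega
    have h3 := Finset.card_le_card h2
    rw [Finset.card_range] at h3
    change r y ≤ r y - 1 at h3
    omega
  rw [Finset.sum_range] at hsum
  -- The target heads every complete vote and is barred from the other places. Dropping it costs at
  -- most `k` of the `k * L` places, which leaves `k * (L - 1)`.
  obtain ⟨l, hl1, hl2, hl3⟩ := exists_finsets_card_filter_mem_le (L - 1) k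
    (fun y => if y = I.target then 0 else r y) (fun y => by
      split_ifs; exacts [Nat.zero_le _, hrk y]) (by
      have h1 : ∑ y, (if y = I.target then 0 else r y) + r I.target = ∑ y, r y := by
        rw [← Finset.add_sum_erase _ r (Finset.mem_univ I.target),
          ← Finset.add_sum_erase _ (fun y => if y = I.target then 0 else r y)
          (Finset.mem_univ I.target), Finset.sum_congr rfl (g := r)
          (fun y hy => if_neg (Finset.ne_of_mem_erase hy))]
        simp [Nat.add_comm]
      have h2 := hrk I.target
      have h3 : k * L = k * (L - 1) + k := by
        conv_lhs => rw [show L = L - 1 + 1 by omega]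
        ring
      change k * L ≤ ∑ y, r y at hsum
      omega)
  have hnot : ∀ u ∈ l, I.target ∉ u := by
    intro u hu hmem
    have := hl3 I.target
    rw [if_pos rfl, Nat.le_zero, List.countP_eq_zero] at this
    exact this u hu (by simpa using hmem)
  let full : {u // u ∈ l} → UpToVote L I.numCandidates := fun u =>
    ⟨I.target :: u.1.toList, by
      simpa [Finset.nodup_toList] using hnot u.1 u.2, by simp, by
      simp [hl2 u.1 u.2]; omega⟩
  let single : UpToVote L I.numCandidates := ⟨[I.target], by simp, by simp, by simp; omega⟩
  refine ⟨l.attach.map full ++ List.replicate (I.numAbsent - k) single, by simp [hl1]; omega, ?_⟩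
  rw [downWinner_eq_iff]
  have htarget : profileScore a (l.attach.map full ++ List.replicate (I.numAbsent - k) single)
      I.target = I.numAbsent * b + k * d := by
    have h1 : ∀ u, (full u).downScore a I.target = b + d := by
      intro u
      rw [UpToVote.downScore_eq_flatScore hL a ha hflat]
      have : (full u).1.length = L := by simp [full, hl2 u.1 u.2]; omega
      simp [flatScore, full, b, d, hl2 u.1 u.2]
      omega
    have h2 : single.downScore a I.target = b := by
      rw [UpToVote.downScore_eq_flatScore hL a ha hflat]
      simp [flatScore, single, b]
      omega
    obtain ⟨e, he⟩ := Nat.exists_eq_add_of_le hk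
    simp [profileScore, h1, h2, Function.comp_def, hl1, he]
    ring
  have hother : ∀ y, y ≠ I.target →
      profileScore a (l.attach.map full ++ List.replicate (I.numAbsent - k) single) y ≤ r y * b := by
    intro y hy
    have h1 : ∀ u, (full u).downScore a y = if y ∈ u.1 then b else 0 := by
      intro u
      rw [UpToVote.downScore_eq_flatScore hL a ha hflat]
      simp [flatScore, full, b, Fin.val_inj, hy, hy.symm]
    have h2 : single.downScore a y = 0 := by
      simp [UpToVote.downScore, single, hy]
    have h3 : ∀ l' : List (Finset (Fin I.numCandidates)),
        (l'.map fun u => if y ∈ u then b else 0).sum = l'.countP (y ∈ ·) * b := by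
      intro l'
      induction l' with
      | nil => simp
      | cons u l' ih =>
        simp only [List.map_cons, List.sum_cons, ih, List.countP_cons, Nat.add_mul]
        split_ifs <;> simp_all <;> omega
    have h4 := hl3 y
    rw [if_neg hy] at h4
    rw [profileScore_append]
    have h5 : profileScore a (l.attach.map full) y = l.countP (y ∈ ·) * b := by
      rw [← h3]
      conv_rhs => rw [← List.attach_map_subtype_val l]
      simp only [profileScore, List.map_map]
      congr 1
      exact List.map_congr_left fun u _ => h1 u
    rw [h5]
    simp only [profileScore, List.map_replicate, h2, List.sum_replicate, smul_zero, add_zero]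
    exact Nat.mul_le_mul_right b h4
  intro y
  rw [profileScore_append, profileScore_append a I.known _ I.target, htarget, hs, hs]
  by_cases hy : y = I.target
  · subst hy
    rw [htarget]
    simp
  · have h1 := hother y hy
    have h2 := hrfits y
    simp only [Fits, Fin.val_fin_lt] at h2
    omega

end WAVInstance

/-! ### Arithmetic subroutines -/

namespace LoopProgram

variable {Γ R : Type} [DecidableEq R]

/-- Run a program `n` times. -/
def repeatN (p : LoopProgram Γ R) : ℕ → LoopProgram Γ R
  | 0 => skip
  | n + 1 => seq p (repeatN p n)

/-- Set a register to zero. -/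
def clear (r : R) : LoopProgram Γ R := drain r r

/-- Run a program once for every symbol of the input word. -/
def loop (p : LoopProgram Γ R) : LoopProgram Γ R := forIn fun _ => p

/-- Add the contents of `r` to `t`, and clear `r`, for contents bounded by the length of the input
word. -/
def move (r t : R) : LoopProgram Γ R := loop (ifz r skip (seq (dec r) (inc t)))

/-- Add `n` times the contents of `r` to `t`, for contents bounded by the length of the input
word. -/
def addMul (n : ℕ) (r t tmp : R) : LoopProgram Γ R :=
  seq (loop (ifz r skip (seq (dec r) (seq (inc tmp) (repeatN (inc t) n))))) (move tmp r)

variable (w : List Γ)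

theorem run_repeatN_inc (r : R) (n : ℕ) : ∀ s : R → ℕ,
    (repeatN (inc r) n).run w s = Function.update s r (s r + n) := by
  induction n with
  | zero => intro s; simp [repeatN, run]
  | succ n ih =>
    intro s
    simp [repeatN, run, ih]
    congr 1
    omega

theorem run_repeatN_dec (r : R) (n : ℕ) : ∀ s : R → ℕ,
    (repeatN (dec r) n).run w s = Function.update s r (s r - n) := by
  induction n with
  | zero => intro s; simp [repeatN, run]
  | succ n ih =>
    intro s
    simp [repeatN, run, ih]
    congr 1
    omega

theorem run_clear (r : R) (s : R → ℕ) : (clear r).run w s = Function.update s r 0 := by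
  simp [clear, run]

theorem run_loop (p : LoopProgram Γ R) (s : R → ℕ) :
    (loop p).run w s = (p.run w)^[w.length] s := by
  simp only [loop, run]
  exact List.foldl_const _ _ _

theorem run_move {r t : R} (hrt : r ≠ t) (s : R → ℕ) (hs : s r ≤ w.length) :
    (move r t).run w s = Function.update (Function.update s t (s t + s r)) r 0 := by
  -- Loop invariant; rounds beyond `s r` are idle.
  have h : ∀ n, ((ifz r skip (seq (dec r) (inc t))).run w)^[n] s =
      Function.update (Function.update s t (s t + min n (s r))) r (s r - n) := by
    intro n
    induction n with
    | zero => simp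
    | succ n ih =>
      rw [Function.iterate_succ_apply', ih]
      simp only [run]
      funext x
      by_cases h0 : s r - n = 0 <;> obtain rfl | hr := eq_or_ne x r
      · simp [h0]; omega
      · obtain rfl | ht := eq_or_ne x t
        · simp [h0, hr]; omega
        · simp [h0, hr, ht]
      · simp [h0, hrt]; omega
      · obtain rfl | ht := eq_or_ne x t
        · simp [h0, hr]; omega
        · simp [h0, hr, ht]
  rw [move, run_loop, h, Nat.min_eq_right hs, Nat.sub_eq_zero_of_le hs]

theorem run_addMul (n : ℕ) {r t tmp : R} (hrt : r ≠ t) (hr : r ≠ tmp) (ht : t ≠ tmp) (s : R → ℕ)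
    (hs : s r ≤ w.length) (h0 : s tmp = 0) :
    (addMul n r t tmp).run w s = Function.update s t (s t + n * s r) := by
  -- Loop invariant; `tmp` keeps what `r` has lost, so that the final `move` can restore it.
  have h : ∀ k, ((ifz r skip (seq (dec r) (seq (inc tmp) (repeatN (inc t) n)))).run w)^[k] s =
      Function.update (Function.update (Function.update s t (s t + n * min k (s r))) r (s r - k))
        tmp (min k (s r)) := by
    intro k
    induction k with
    | zero => rw [Nat.zero_min, ← h0]; simp [h0]
    | succ k ih =>
      rw [Function.iterate_succ_apply', ih]
      simp only [run, run_repeatN_inc]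
      funext x
      by_cases hk : s r - k = 0
      · rw [Nat.min_eq_right (by omega : s r ≤ k), Nat.min_eq_right (by omega : s r ≤ k + 1)]
        simp [hr, hk, (by omega : s r - (k + 1) = 0)]
      · rw [Nat.min_eq_left (by omega : k ≤ s r), Nat.min_eq_left (by omega : k + 1 ≤ s r)]
        obtain rfl | hxt := eq_or_ne x t
        · simp [hr, hk, ht, hrt.symm]; ring
        · obtain rfl | hxr := eq_or_ne x r
          · simp [hr, hk, hxt]; omega
          · obtain rfl | hxm := eq_or_ne x tmp
            · simp [hr, hk, hxr, hxt]
            · simp [hr, hk, hxr, hxt, hxm]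
  rw [addMul, run, run_loop, h, Nat.min_eq_right hs, Nat.sub_eq_zero_of_le hs,
    run_move w hr.symm _ (by simpa using hs)]
  funext x
  simp only [Function.update_apply, hr, hr.symm, if_true, if_false]
  split_ifs <;> simp_all

end LoopProgram

/-! ### The program for the decision problem -/

namespace WAVInstance

open LoopProgram Computability

/-- The registers of the program for the winner with absent votes problem. -/
inductive Reg : Type
  | field₁ | field₂ | field₃ | numCands | absent | target
  | inVote | moved | over | pos | first
  | cand | full | bonus
  | targetScore | candScore
  | diff | copy | spare
  | slots | bad | answer
  deriving DecidableEq

instance : Fintype Reg :=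
  ⟨{.field₁, .field₂, .field₃, .numCands, .absent, .target, .inVote, .moved, .over, .pos, .first,
    .cand, .full, .bonus, .targetScore, .candScore, .diff, .copy, .spare, .slots, .bad, .answer},
    fun r => by cases r <;> decide⟩

abbrev Program := LoopProgram Γ' Reg

/-- Read the first three components of the input. -/
def parse : Program := forIn fun
  | .bit _ => ifz .field₁ (inc .numCands) (ifz .field₂ (inc .absent)
      (ifz .field₃ (inc .target) skip))
  | .comma => ifz .field₁ (inc .field₁) (ifz .field₂ (inc .field₂)
      (ifz .field₃ (inc .field₃) skip))
  | _ => skip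

/-- The register of the candidate to be scored: the target candidate or the current one. -/
def idx : Bool → Reg
  | true => .target
  | false => .cand

/-- The register of the score of the target candidate or the current one. -/
def acc : Bool → Reg
  | true => .targetScore
  | false => .candScore

/-- The part of `scan` for one symbol. -/
def scanSymbol (L b d : ℕ) (i : Bool) : Γ' → Program
  | .bit _ => ifz .inVote skip (ifz (idx i) (inc .over) (seq (dec (idx i)) (inc .moved)))
  | .comma => ifz .inVote skip (seq
      (ifz .over (ifz (idx i) (seq (repeatN (inc (acc i)) b) (ifz .pos (inc .first) skip)) skip)
        skip)
      (seq (inc .pos) (seq (move .moved (idx i)) (clear .over))))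
  | .bra => inc .inVote
  | .ket => seq (repeatN (dec .pos) (L - 1)) (seq
      (ifz .first skip (ifz .pos skip (repeatN (inc (acc i)) d)))
      (seq (clear .first) (seq (clear .pos) (clear .inVote))))
  | .blank => skip

/-- Add the score in the known votes of the target candidate or the current one. -/
def scan (L b d : ℕ) (i : Bool) : Program := forIn (scanSymbol L b d i)

/-- Run `p` if the contents of `x` are less than the contents of `y`, and `q` otherwise. -/
def ifLt (x y : Reg) (p q : Program) : Program :=
  seq (addMul 1 y .diff .spare) (seq (addMul 1 x .copy .spare) (seq (drain .copy .diff)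
    (ifz .diff q (seq (clear .diff) p))))

/-- Compute the two sides of the inequality `Fits`. -/
def tally (L b d : ℕ) : Program :=
  seq (scan L b d true) (seq (scan L b d false) (seq (addMul b .absent .targetScore .spare)
    (seq (addMul d .full .targetScore .spare) (seq (ifLt .cand .target (inc .candScore) skip)
      (addMul b .bonus .candScore .spare)))))

/-- Run `p` if `Fits` holds, and `q` otherwise. -/
def ifFits (L b d : ℕ) (p q : Program) : Program :=
  seq (tally L b d) (seq (drain .targetScore .candScore)
    (ifz .candScore p (seq (clear .candScore) q)))

/-- Subtract from `slots` the number of complete rankings in which the current candidate fits. -/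
def bonusBody (L b d : ℕ) : Program :=
  ifLt .bonus .full (seq (inc .bonus) (ifFits L b d (dec .slots) skip)) skip

/-- Process the current candidate. -/
def candBody (L b d : ℕ) : Program :=
  seq (ifLt .cand .numCands (seq (ifFits L b d skip (inc .bad))
    (seq (loop (bonusBody L b d)) (clear .bonus))) skip) (inc .cand)

/-- Process the current number of complete rankings. -/
def fullBody (L b d : ℕ) : Program :=
  seq (ifLt .absent .full skip (seq (addMul L .full .slots .spare)
    (seq (loop (candBody L b d)) (seq (clear .cand)
      (seq (ifz .bad (ifz .slots (inc .answer) skip) skip) (seq (clear .bad) (clear .slots)))))))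
    (inc .full)

/-- The program for the winner with absent votes problem. -/
def program (L b d : ℕ) : Program := seq parse (loop (fullBody L b d))

/-! ### Correctness of the scoring pass -/

section Scan

variable (w : List Γ') (L b d : ℕ) (i : Bool)

/-- The unary index is compared with `idx i` by cancellation: matched marks pass from `idx i` to
`moved`, surplus input marks go to `over`. -/
theorem foldl_scanSymbol_unary (n : ℕ) : ∀ s : Reg → ℕ, s .inVote = 1 →
    (encodeUnary n).foldl (fun s x => (scanSymbol L b d i x).run w s) s =
      Function.update (Function.update (Function.update s (idx i) (s (idx i) - n))
        .moved (s .moved + min n (s (idx i)))) .over (s .over + (n - s (idx i))) := by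
  induction n with
  | zero =>
    intro s _
    simp [encodeUnary]
  | succ n ih =>
    intro s hs
    have h1 : (scanSymbol L b d i (.bit true)).run w s =
        if s (idx i) = 0 then Function.update s .over (s .over + 1) else
          Function.update (Function.update s (idx i) (s (idx i) - 1)) .moved (s .moved + 1) := by
      by_cases h0 : s (idx i) = 0
      · simp [scanSymbol, run, hs, h0]
      · have : idx i ≠ .moved := by cases i <;> decide
        simp [scanSymbol, run, hs, h0, this.symm]
    unfold encodeUnary at ih ⊢
    rw [List.replicate_succ, List.foldl_cons, h1]
    split_ifs with h0
    · rw [ih _ (by simpa using hs)]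
      cases i <;> simp only [idx] at h0 ⊢ <;> funext r <;> cases r <;> simp [h0] <;> omega
    · rw [ih _ (by cases i <;> simpa [idx] using hs)]
      cases i <;> simp only [idx] at h0 ⊢ <;> funext r <;> cases r <;> simp <;> omega

-- At the comma the two indices agree iff both `idx i` and `over` are zero. Then `moved` is returned
-- to `idx i`, which needs the bound `h4`, so the register survives the comparison.
set_option maxHeartbeats 1000000 in
theorem foldl_scanSymbol_index (x : ℕ) (s : Reg → ℕ) (h1 : s .inVote = 1) (h2 : s .moved = 0)
    (h3 : s .over = 0) (h4 : s (idx i) ≤ w.length) :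
    (encodeUnary x ++ [Γ'.comma]).foldl (fun s x => (scanSymbol L b d i x).run w s) s =
      Function.update (Function.update (Function.update s
        (acc i) (s (acc i) + if x = s (idx i) then b else 0))
        .first (s .first + if s .pos = 0 ∧ x = s (idx i) then 1 else 0)) .pos (s .pos + 1) := by
  rw [List.foldl_append, foldl_scanSymbol_unary w L b d i x s h1]
  simp only [List.foldl_cons, List.foldl_nil, h2, h3, Nat.zero_add]
  set s₁ : Reg → ℕ := Function.update (Function.update (Function.update s (idx i) (s (idx i) - x))
    .moved (min x (s (idx i)))) .over (x - s (idx i)) with hs₁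
  set p : Program := ifz .over (ifz (idx i) (seq (repeatN (inc (acc i)) b)
    (ifz .pos (inc .first) skip)) skip) skip with hp
  have hp' : p.run w s₁ = Function.update (Function.update s₁
        (acc i) (s (acc i) + if x = s (idx i) then b else 0))
        .first (s .first + if s .pos = 0 ∧ x = s (idx i) then 1 else 0) := by
    simp only [hp, run, run_repeatN_inc]
    cases i <;> simp only [idx, acc] at hs₁ ⊢
    · by_cases hx : x = s .cand
      · by_cases hpos : s .pos = 0 <;> funext r <;> cases r <;> simp [hs₁, hx, hpos]
      · by_cases hx1 : x - s .cand = 0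
        · have hx2 : s .cand - x ≠ 0 := by omega
          funext r; cases r <;> simp [hs₁, hx, hx1, hx2]
        · funext r; cases r <;> simp [hs₁, hx, hx1]
    · by_cases hx : x = s .target
      · by_cases hpos : s .pos = 0 <;> funext r <;> cases r <;> simp [hs₁, hx, hpos]
      · by_cases hx1 : x - s .target = 0
        · have hx2 : s .target - x ≠ 0 := by omega
          funext r; cases r <;> simp [hs₁, hx, hx1, hx2]
        · funext r; cases r <;> simp [hs₁, hx, hx1]
  have hv : s₁ .inVote ≠ 0 := by cases i <;> simp [hs₁, idx, h1]
  rw [show scanSymbol L b d i .comma = ifz .inVote skip (seq p (seq (inc .pos)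
    (seq (move .moved (idx i)) (clear .over)))) from rfl]
  simp only [run, hv, if_false, run_clear, hp']
  rw [run_move w (by cases i <;> decide)]
  · clear_value p
    cases i <;> simp only [idx, acc] at hs₁ ⊢ <;> funext r <;> cases r <;>
      simp [hs₁, h1, h2, h3]
    · omega
    · omega
  · cases i <;> simp [hs₁, idx, acc] at h4 ⊢ <;> omega

theorem foldl_scanSymbol_ranking (V : List ℕ) : ∀ (s : Reg → ℕ), s .inVote = 1 → s .moved = 0 →
    s .over = 0 → s (idx i) ≤ w.length →
    (V.flatMap fun x => encodeUnary x ++ [Γ'.comma]).foldl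
        (fun s x => (scanSymbol L b d i x).run w s) s =
      Function.update (Function.update (Function.update s
        (acc i) (s (acc i) + V.count (s (idx i)) * b))
        .first (s .first + if s .pos = 0 ∧ V.head? = some (s (idx i)) then 1 else 0))
        .pos (s .pos + V.length) := by
  induction V with
  | nil => intro s _ _ _ _; simp
  | cons x V ih =>
    intro s h1 h2 h3 h4
    rw [List.flatMap_cons, List.foldl_append, foldl_scanSymbol_index w L b d i x s h1 h2 h3 h4,
      ih _ (by cases i <;> simpa [acc] using h1) (by cases i <;> simpa [acc] using h2)
      (by cases i <;> simpa [acc] using h3) (by cases i <;> simpa [acc, idx] using h4)]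
    cases i <;> simp only [idx, acc]
    · by_cases hx : x = s .cand <;> by_cases hp : s .pos = 0 <;> funext r <;> cases r <;>
        simp [hx, hp, Nat.add_mul] <;> omega
    · by_cases hx : x = s .target <;> by_cases hp : s .pos = 0 <;> funext r <;> cases r <;>
        simp [hx, hp, Nat.add_mul] <;> omega

theorem foldl_scanSymbol_vote {m : ℕ} (V : UpToVote L m) (s : Reg → ℕ) (h1 : s .inVote = 0)
    (h2 : s .moved = 0) (h3 : s .over = 0) (h4 : s .first = 0) (h5 : s .pos = 0)
    (h6 : s (idx i) ≤ w.length) :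
    (encodeVote V).foldl (fun s x => (scanSymbol L b d i x).run w s) s =
      Function.update s (acc i) (s (acc i) + flatScore L b d (V.1.map Fin.val) (s (idx i))) := by
  have henc : encodeVote V = Γ'.bra ::
      ((V.1.map Fin.val).flatMap fun x => encodeUnary x ++ [Γ'.comma]) ++ [Γ'.ket] := by
    rw [List.flatMap_map]; rfl
  have hnodup : (V.1.map Fin.val).Nodup := V.2.1.map Fin.val_injective
  have hlen : (V.1.map Fin.val).length ≤ L := by simpa using V.2.2.2
  have hpos : 1 ≤ (V.1.map Fin.val).length := by simpa using V.2.2.1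
  generalize V.1.map Fin.val = U at henc hnodup hlen hpos ⊢
  have hbra : (scanSymbol L b d i .bra).run w s = Function.update s .inVote 1 := by
    simp [scanSymbol, run, h1]
  rw [henc, List.cons_append, List.foldl_cons, List.foldl_append, hbra,
    foldl_scanSymbol_ranking w L b d i U _ (by simp) (by simpa using h2) (by simpa using h3)
    (by cases i <;> simpa [idx] using h6)]
  -- Without repetitions, the number of matches found by the scan is 0 or 1.
  have hscore : ∀ y, flatScore L b d U y =
      U.count y * b + if U.head? = some y ∧ U.length = L then d else 0 := by
    intro y
    unfold flatScore
    congr 1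
    split_ifs with hy
    · rw [List.count_eq_one_of_mem hnodup hy, Nat.one_mul]
    · rw [List.count_eq_zero_of_not_mem hy, Nat.zero_mul]
  -- After `L - 1` decrements `pos` is nonzero exactly for a complete ranking, as no ranking is
  -- longer than `L`.
  have hfull : U.length - (L - 1) = if U.length = L then 1 else 0 := by split_ifs <;> omega
  simp only [List.foldl_cons, List.foldl_nil, scanSymbol, run, run_repeatN_inc, run_repeatN_dec,
    run_clear, hscore]
  cases i <;> simp only [idx, acc]
  · by_cases ha : U.head? = some (s .cand) <;> by_cases hb : U.length = L <;>
      simp only [hb, if_true, if_false] at hfull <;> funext r <;> cases r <;>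
      simp [ha, hb, hfull, h1, h4, h5, Nat.add_assoc]
  · by_cases ha : U.head? = some (s .target) <;> by_cases hb : U.length = L <;>
      simp only [hb, if_true, if_false] at hfull <;> funext r <;> cases r <;>
      simp [ha, hb, hfull, h1, h4, h5, Nat.add_assoc]

theorem foldl_scanSymbol_votes {m : ℕ} (P : List (UpToVote L m)) : ∀ (s : Reg → ℕ),
    s .inVote = 0 → s .moved = 0 → s .over = 0 → s .first = 0 → s .pos = 0 →
    s (idx i) ≤ w.length →
    (P.flatMap encodeVote).foldl (fun s x => (scanSymbol L b d i x).run w s) s =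
      Function.update s (acc i) (s (acc i) +
        (P.map fun V => flatScore L b d (V.1.map Fin.val) (s (idx i))).sum) := by
  induction P with
  | nil => intro s _ _ _ _ _ _; simp
  | cons V P ih =>
    intro s h1 h2 h3 h4 h5 h6
    rw [List.flatMap_cons, List.foldl_append, foldl_scanSymbol_vote w L b d i V s h1 h2 h3 h4 h5 h6,
      ih _ (by cases i <;> simpa [acc] using h1) (by cases i <;> simpa [acc] using h2)
      (by cases i <;> simpa [acc] using h3) (by cases i <;> simpa [acc] using h4)
      (by cases i <;> simpa [acc] using h5) (by cases i <;> simpa [acc, idx] using h6)]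
    have hne : Function.update s (acc i) (s (acc i) + flatScore L b d (V.1.map Fin.val) (s (idx i)))
      (idx i) = s (idx i) := Function.update_of_ne (by cases i <;> decide) _ _
    rw [hne]
    simp [Nat.add_assoc]

/-- The header fields precede all brackets, so `inVote` is zero and the scan ignores them. -/
theorem foldl_scanSymbol_outside (s : Reg → ℕ) (h1 : s .inVote = 0) (n : ℕ) (u : List Γ') :
    (encodeUnary n ++ Γ'.comma :: u).foldl (fun s x => (scanSymbol L b d i x).run w s) s =
      u.foldl (fun s x => (scanSymbol L b d i x).run w s) s := by
  rw [List.foldl_append, List.foldl_cons]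
  have h2 : (encodeUnary n).foldl (fun s x => (scanSymbol L b d i x).run w s) s = s := by
    induction n with
    | zero => rfl
    | succ n ih =>
      unfold encodeUnary at ih ⊢
      rw [List.replicate_succ, List.foldl_cons,
        show (scanSymbol L b d i (.bit true)).run w s = s by simp [scanSymbol, run, h1], ih]
  rw [h2, show (scanSymbol L b d i .comma).run w s = s by simp [scanSymbol, run, h1]]

theorem run_scan (I : WAVInstance L) (s : Reg → ℕ) (h1 : s .inVote = 0) (h2 : s .moved = 0)
    (h3 : s .over = 0) (h4 : s .first = 0) (h5 : s .pos = 0) (h6 : s (idx i) ≤ I.encode.length) :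
    (scan L b d i).run I.encode s =
      Function.update s (acc i) (s (acc i) + I.knownScore b d (s (idx i))) := by
  unfold scan run
  conv_lhs => rw [encode]
  rw [foldl_scanSymbol_outside _ _ _ _ _ _ h1, foldl_scanSymbol_outside _ _ _ _ _ _ h1,
    foldl_scanSymbol_outside _ _ _ _ _ _ h1]
  exact foldl_scanSymbol_votes _ L b d i I.known s h1 h2 h3 h4 h5 h6

end Scan

end WAVInstance

/-! ### Comparisons and register bookkeeping -/

namespace WAVInstance

open LoopProgram Computability

section Control

theorem run_seq {Γ R : Type} [DecidableEq R] (w : List Γ) (p q : LoopProgram Γ R) (s : R → ℕ) :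
    (seq p q).run w s = q.run w (p.run w s) := rfl

theorem run_ifz_pos {Γ R : Type} [DecidableEq R] {w : List Γ} {r : R} {s : R → ℕ} (h : s r = 0)
    (p q : LoopProgram Γ R) : (ifz r p q).run w s = p.run w s := if_pos h

theorem run_ifz_neg {Γ R : Type} [DecidableEq R] {w : List Γ} {r : R} {s : R → ℕ} (h : s r ≠ 0)
    (p q : LoopProgram Γ R) : (ifz r p q).run w s = q.run w s := if_neg h

variable (w : List Γ') {L : ℕ} (b d : ℕ)

/-- The registers used by `ifLt` and `addMul` are free. -/
def IsScratch (r : Reg) : Prop := r = .diff ∨ r = .copy ∨ r = .spare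

/-- Truncated subtraction on copies: `s y - s x` is nonzero iff `s x < s y`. The scratch registers
are zero again before either branch starts. -/
theorem run_ifLt {x y : Reg} (hx : ¬ IsScratch x) (hy : ¬ IsScratch y) (p q : Program)
    (s : Reg → ℕ) (hs : ∀ r, IsScratch r → s r = 0) (hsx : s x ≤ w.length) (hsy : s y ≤ w.length) :
    (ifLt x y p q).run w s = if s x < s y then p.run w s else q.run w s := by
  unfold IsScratch at *
  push Not at hx hy
  have h1 := hs .diff (by simp)
  have h2 := hs .copy (by simp)
  have h3 := hs .spare (by simp)
  have hstep : (drain .copy .diff : Program).run w ((addMul 1 x .copy .spare).run w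
      ((addMul 1 y .diff .spare).run w s)) = Function.update s .diff (s y - s x) := by
    rw [run_addMul w 1 hy.1 hy.2.2 (by decide) s hsy h3,
      run_addMul w 1 hx.2.1 hx.2.2 (by decide) _ (by simpa [Function.update_of_ne hx.1] using hsx)
        (by simpa using h3)]
    funext r
    by_cases hd : r = .diff
    · subst hd; simp [run, h1, h2, hx.1]
    · by_cases hc : r = .copy
      · subst hc; simp [run, h2]
      · simp [run, hd, hc]
  have hdiff : Function.update s .diff 0 = s := by rw [← h1, Function.update_eq_self]
  rw [ifLt, run_seq, run_seq, run_seq, hstep]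
  by_cases hlt : s x < s y
  · rw [run_ifz_neg (by simp; omega), run_seq, run_clear, Function.update_idem, hdiff, if_pos hlt]
  · rw [Nat.sub_eq_zero_of_le (not_lt.1 hlt), hdiff, run_ifz_pos h1, if_neg hlt]

end Control

/-- The contents of the registers between the parts of the program. -/
structure Vars where
  (numCands absent target cand full bonus targetScore candScore slots bad answer : ℕ)

namespace Vars

/-- The register contents with given contents of the main registers. -/
def store (v : Vars) : Reg → ℕ
  | .field₁ | .field₂ | .field₃ => 1
  | .numCands => v.numCands
  | .absent => v.absent
  | .target => v.target
  | .cand => v.cand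
  | .full => v.full
  | .bonus => v.bonus
  | .targetScore => v.targetScore
  | .candScore => v.candScore
  | .slots => v.slots
  | .bad => v.bad
  | .answer => v.answer
  | _ => 0

/-- The registers which are read by loops over the input word are bounded by its length. -/
structure Bounded (v : Vars) (n : ℕ) : Prop where
  numCands : v.numCands ≤ n
  absent : v.absent ≤ n
  target : v.target ≤ n
  cand : v.cand ≤ n
  full : v.full ≤ n
  bonus : v.bonus ≤ n

variable (v : Vars) (n : ℕ)

theorem store_of_isScratch (r : Reg) (h : IsScratch r) : v.store r = 0 := by
  obtain rfl | rfl | rfl := h <;> rfl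

theorem update_store_cand : Function.update v.store .cand n = { v with cand := n }.store := by
  funext r; cases r <;> simp [store]

theorem update_store_full : Function.update v.store .full n = { v with full := n }.store := by
  funext r; cases r <;> simp [store]

theorem update_store_bonus : Function.update v.store .bonus n = { v with bonus := n }.store := by
  funext r; cases r <;> simp [store]

theorem update_store_targetScore :
    Function.update v.store .targetScore n = { v with targetScore := n }.store := by
  funext r; cases r <;> simp [store]

theorem update_store_candScore :
    Function.update v.store .candScore n = { v with candScore := n }.store := by
  funext r; cases r <;> simp [store]

theorem update_store_slots : Function.update v.store .slots n = { v with slots := n }.store := by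
  funext r; cases r <;> simp [store]

theorem update_store_bad : Function.update v.store .bad n = { v with bad := n }.store := by
  funext r; cases r <;> simp [store]

theorem update_store_answer : Function.update v.store .answer n = { v with answer := n }.store := by
  funext r; cases r <;> simp [store]

end Vars

/-! ### Correctness of the search loops -/

section Main

open Vars

variable {L : ℕ} (I : WAVInstance L) (b d : ℕ)

section Store

variable {w : List Γ'} {v : Vars} (hv : v.Bounded w.length)

include hv

theorem run_addMul_absent (n : ℕ) : (addMul n .absent .targetScore .spare).run w v.store =
    { v with targetScore := v.targetScore + n * v.absent }.store :=
  (run_addMul w n (r := Reg.absent) (by decide) (by decide) (by decide) v.store hv.absent rfl).trans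
    (update_store_targetScore v _)

theorem run_addMul_full (n : ℕ) : (addMul n .full .targetScore .spare).run w v.store =
    { v with targetScore := v.targetScore + n * v.full }.store :=
  (run_addMul w n (r := Reg.full) (by decide) (by decide) (by decide) v.store hv.full rfl).trans
    (update_store_targetScore v _)

theorem run_addMul_bonus (n : ℕ) : (addMul n .bonus .candScore .spare).run w v.store =
    { v with candScore := v.candScore + n * v.bonus }.store :=
  (run_addMul w n (r := Reg.bonus) (by decide) (by decide) (by decide) v.store hv.bonus rfl).trans
    (update_store_candScore v _)

theorem run_addMul_slots (n : ℕ) : (addMul n .full .slots .spare).run w v.store =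
    { v with slots := v.slots + n * v.full }.store :=
  (run_addMul w n (r := Reg.full) (by decide) (by decide) (by decide) v.store hv.full rfl).trans
    (update_store_slots v _)

variable (p q : Program)

theorem run_ifLt_cand_target : (ifLt .cand .target p q).run w v.store =
    if v.cand < v.target then p.run w v.store else q.run w v.store :=
  run_ifLt w (by simp [IsScratch]) (by simp [IsScratch]) p q v.store v.store_of_isScratch
    hv.cand hv.target

theorem run_ifLt_cand_numCands : (ifLt .cand .numCands p q).run w v.store =
    if v.cand < v.numCands then p.run w v.store else q.run w v.store :=
  run_ifLt w (by simp [IsScratch]) (by simp [IsScratch]) p q v.store v.store_of_isScratch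
    hv.cand hv.numCands

theorem run_ifLt_bonus_full : (ifLt .bonus .full p q).run w v.store =
    if v.bonus < v.full then p.run w v.store else q.run w v.store :=
  run_ifLt w (by simp [IsScratch]) (by simp [IsScratch]) p q v.store v.store_of_isScratch
    hv.bonus hv.full

theorem run_ifLt_absent_full : (ifLt .absent .full p q).run w v.store =
    if v.absent < v.full then p.run w v.store else q.run w v.store :=
  run_ifLt w (by simp [IsScratch]) (by simp [IsScratch]) p q v.store v.store_of_isScratch
    hv.absent hv.full

end Store

theorem run_tally (v : Vars) (hv : v.Bounded I.encode.length) (hP : v.targetScore = 0)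
    (hQ : v.candScore = 0) :
    (tally L b d).run I.encode v.store = { v with
      targetScore := I.knownScore b d v.target + v.absent * b + v.full * d
      candScore := I.knownScore b d v.cand + (if v.cand < v.target then 1 else 0) + v.bonus * b
      }.store := by
  have h1 : ∀ v : Vars, v.Bounded I.encode.length → (scan L b d true).run I.encode v.store =
      { v with targetScore := v.targetScore + I.knownScore b d v.target }.store := fun v hv =>
    (run_scan L b d true I v.store rfl rfl rfl rfl rfl hv.target).trans
      (update_store_targetScore v _)
  have h2 : ∀ v : Vars, v.Bounded I.encode.length → (scan L b d false).run I.encode v.store =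
      { v with candScore := v.candScore + I.knownScore b d v.cand }.store := fun v hv =>
    (run_scan L b d false I v.store rfl rfl rfl rfl rfl hv.cand).trans
      (update_store_candScore v _)
  have h3 : ∀ v : Vars, v.Bounded I.encode.length →
      (ifLt .cand .target (inc .candScore) skip).run I.encode v.store =
      { v with candScore := v.candScore + if v.cand < v.target then 1 else 0 }.store := by
    intro v hv
    rw [run_ifLt_cand_target hv]
    split_ifs
    · exact update_store_candScore v _
    · rfl
  rw [tally, run_seq, run_seq, run_seq, run_seq, run_seq, h1 v hv, h2, run_addMul_absent,
    run_addMul_full, h3, run_addMul_bonus]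
  · simp only [hP, hQ, Nat.zero_add, Nat.mul_comm]
  all_goals exact ⟨hv.1, hv.2, hv.3, hv.4, hv.5, hv.6⟩

/-- Scores need not be bounded by the length of the word, so they are compared by `drain` instead of
`ifLt`. This destroys both scores, leaving zeros for the next test. -/
theorem run_ifFits (p q : Program) (v : Vars) (hv : v.Bounded I.encode.length)
    (hP : v.targetScore = 0) (hQ : v.candScore = 0) :
    (ifFits L b d p q).run I.encode v.store =
      if Fits b d (I.knownScore b d) v.target v.absent v.full v.cand v.bonus then
        p.run I.encode v.store else q.run I.encode v.store := by
  have h0 : v = { v with targetScore := 0, candScore := 0 } := by cases v; simp_all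
  rw [ifFits, run_seq, run_tally I b d v hv hP hQ, run_seq]
  simp only [run, update_store_candScore, update_store_targetScore]
  by_cases h : Fits b d (I.knownScore b d) v.target v.absent v.full v.cand v.bonus
  · rw [if_pos h]
    refine (if_pos (Nat.sub_eq_zero_of_le h)).trans ?_
    simp only [store]
    rw [Nat.sub_eq_zero_of_le h, ← h0]
  · rw [if_neg h]
    refine (if_neg fun h' => h (Nat.le_of_sub_eq_zero h')).trans ?_
    rw [run_clear, update_store_candScore, ← h0]

/-- The condition `Fits` for the register contents. -/
abbrev FitsFor (v : Vars) (j : ℕ) : Prop :=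
  Fits b d (I.knownScore b d) v.target v.absent v.full v.cand j

/-- The number of complete rankings in which a candidate fits. -/
def fitCount (v : Vars) (n : ℕ) : ℕ :=
  ((Finset.range n).filter fun j => FitsFor I b d v (j + 1)).card

theorem fitCount_succ (v : Vars) (n : ℕ) : fitCount I b d v (n + 1) =
    fitCount I b d v n + if FitsFor I b d v (n + 1) then 1 else 0 := by
  unfold fitCount
  rw [Finset.range_add_one, Finset.filter_insert]
  split_ifs with h
  · rw [Finset.card_insert_of_notMem (by simp)]
  · rfl

/-- The loop runs as often as the word is long; rounds after `bonus` has reached `full` do nothing,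
whence the minimum. -/
theorem iterate_bonusBody (v : Vars) (hv : v.Bounded I.encode.length)
    (hP : v.targetScore = 0) (hQ : v.candScore = 0) (hb : v.bonus = 0) (n : ℕ) :
    ((bonusBody L b d).run I.encode)^[n] v.store = { v with
      bonus := min n v.full
      slots := v.slots - fitCount I b d v (min n v.full) }.store := by
  have hfull := hv.full
  induction n with
  | zero =>
    have : ({ v with bonus := 0 } : Vars) = v := by cases v; simp_all
    simp [fitCount, this]
  | succ n ih =>
    rw [Function.iterate_succ_apply', ih, bonusBody, run_ifLt_bonus_full (v := { v with
      bonus := min n v.full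
      slots := v.slots - fitCount I b d v (min n v.full) })
      ⟨hv.1, hv.2, hv.3, hv.4, hv.5, (min_le_right n _).trans hv.full⟩]
    dsimp only
    by_cases hn : n < v.full
    · rw [Nat.min_eq_left hn.le, Nat.min_eq_left (Nat.succ_le_of_lt hn), if_pos hn]
      simp only [run, update_store_bonus]
      refine (run_ifFits I b d _ _ { v with
        bonus := n + 1
        slots := v.slots - fitCount I b d v n } ⟨hv.1, hv.2, hv.3, hv.4, hv.5,
        (by omega : n + 1 ≤ _)⟩ hP hQ).trans ?_
      rw [fitCount_succ]
      simp only [run, update_store_slots, store]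
      split_ifs with h
      · simp only [Nat.sub_sub]
      · rfl
    · rw [Nat.min_eq_right (by omega : v.full ≤ n), Nat.min_eq_right (by omega : v.full ≤ n + 1),
        if_neg (lt_irrefl v.full)]
      rfl

theorem run_candBody (v : Vars) (hv : v.Bounded I.encode.length)
    (hP : v.targetScore = 0) (hQ : v.candScore = 0) (hb : v.bonus = 0) :
    (candBody L b d).run I.encode v.store = if v.cand < v.numCands then { v with
        cand := v.cand + 1
        bad := v.bad + if FitsFor I b d v 0 then 0 else 1
        slots := v.slots - fitCount I b d v v.full }.store
      else { v with cand := v.cand + 1 }.store := by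
  have hinc : ∀ v : Vars, (inc .cand : Program).run I.encode v.store =
      { v with cand := v.cand + 1 }.store := fun v => update_store_cand v _
  rw [candBody, run_seq, run_ifLt_cand_numCands hv]
  by_cases hc : v.cand < v.numCands
  · have hbad : (ifFits L b d skip (inc .bad)).run I.encode v.store =
        ({ v with bad := v.bad + if FitsFor I b d v 0 then 0 else 1 } : Vars).store := by
      rw [run_ifFits I b d _ _ _ hv hP hQ]
      by_cases h0 : FitsFor I b d v 0
      · rw [if_pos (by rw [hb]; exact h0), if_pos h0]
        rfl
      · rw [if_neg (by rw [hb]; exact h0), if_neg h0]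
        exact update_store_bad v _
    rw [if_pos hc, if_pos hc, run_seq, hbad, run_seq, run_loop,
      iterate_bonusBody I b d { v with bad := v.bad + if FitsFor I b d v 0 then 0 else 1 } ⟨hv.1, hv.2, hv.3, hv.4, hv.5, hv.6⟩ hP hQ hb, run_clear,
      update_store_bonus, hinc, Nat.min_eq_right hv.full]
    have : ({ v with bonus := 0 } : Vars) = v := by cases v; simp_all
    conv_rhs => rw [← this]
    rfl
  · rw [if_neg hc, if_neg hc]
    exact hinc v

/-- The number of candidates which do not fit even if they get no additional points. -/
def badCount (v : Vars) (n : ℕ) : ℕ :=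
  ((Finset.range n).filter fun y => ¬ FitsFor I b d { v with cand := y } 0).card

theorem badCount_succ (v : Vars) (n : ℕ) : badCount I b d v (n + 1) =
    badCount I b d v n + if FitsFor I b d { v with cand := n } 0 then 0 else 1 := by
  unfold badCount
  rw [Finset.range_add_one, Finset.filter_insert]
  by_cases h : FitsFor I b d { v with cand := n } 0
  · rw [if_neg (not_not.2 h), if_pos h, Nat.add_zero]
  · rw [if_pos h, if_neg h, Finset.card_insert_of_notMem (by simp)]

/-- The total number of places in complete rankings which can be filled. -/
def totalCount (v : Vars) (n : ℕ) : ℕ :=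
  ∑ y ∈ Finset.range n, fitCount I b d { v with cand := y } v.full

/-- `cand` also grows in the idle rounds, so the bound on `n` is needed to keep its comparisons
valid. -/
theorem iterate_candBody (v : Vars) (hv : v.Bounded I.encode.length)
    (hP : v.targetScore = 0) (hQ : v.candScore = 0) (hb : v.bonus = 0) (hc : v.cand = 0)
    (n : ℕ) (hn : n ≤ I.encode.length) :
    ((candBody L b d).run I.encode)^[n] v.store = { v with
      cand := n
      bad := v.bad + badCount I b d v (min n v.numCands)
      slots := v.slots - totalCount I b d v (min n v.numCands) }.store := by
  induction n with
  | zero =>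
    have : ({ v with cand := 0 } : Vars) = v := by cases v; simp_all
    simp [badCount, totalCount, this]
  | succ n ih =>
    rw [Function.iterate_succ_apply', ih (by omega), run_candBody I b d
      { v with
        cand := n
        bad := v.bad + badCount I b d v (min n v.numCands)
        slots := v.slots - totalCount I b d v (min n v.numCands) } ⟨hv.1, hv.2, hv.3, (by omega : n ≤ _), hv.5, hv.6⟩ hP hQ hb]
    dsimp only
    by_cases h : n < v.numCands
    · rw [if_pos h, Nat.min_eq_left h.le, Nat.min_eq_left (Nat.succ_le_of_lt h), badCount_succ,
        totalCount, totalCount, Finset.sum_range_succ, Nat.sub_sub, Nat.add_assoc]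
      rfl
    · rw [if_neg h, Nat.min_eq_right (by omega : v.numCands ≤ n),
        Nat.min_eq_right (by omega : v.numCands ≤ n + 1)]

/-- Whether the current number of complete rankings is a solution. -/
def Success (v : Vars) : Prop :=
  v.full ≤ v.absent ∧ badCount I b d v v.numCands = 0 ∧
    L * v.full - totalCount I b d v v.numCands = 0

instance (v : Vars) : Decidable (Success I b d v) :=
  inferInstanceAs (Decidable (_ ∧ _))

/-- All work registers return to zero, so the trials for different k are independent. The truncated
`slots` vanishes iff the available places suffice. -/
theorem run_fullBody (v : Vars) (hv : v.Bounded I.encode.length)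
    (hP : v.targetScore = 0) (hQ : v.candScore = 0) (hb : v.bonus = 0) (hc : v.cand = 0)
    (hbad : v.bad = 0) (hslots : v.slots = 0) :
    (fullBody L b d).run I.encode v.store = { v with
      full := v.full + 1
      answer := v.answer + if Success I b d v then 1 else 0 }.store := by
  have hinc : ∀ v : Vars, (inc .full : Program).run I.encode v.store =
      { v with full := v.full + 1 }.store := fun v => update_store_full v _
  rw [fullBody, run_seq, run_ifLt_absent_full hv]
  by_cases h : v.absent < v.full
  · rw [if_pos h, if_neg (fun h' => absurd h'.1 (not_le.2 h))]
    exact hinc v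
  · have hle : v.full ≤ v.absent := not_lt.1 h
    have hX : badCount I b d { v with slots := v.slots + L * v.full } v.numCands =
      badCount I b d v v.numCands := rfl
    have hY : totalCount I b d { v with slots := v.slots + L * v.full } v.numCands =
      totalCount I b d v v.numCands := rfl
    rw [if_neg h, run_seq, run_seq, run_seq, run_seq, run_seq, run_loop, run_addMul_slots hv,
      iterate_candBody I b d { v with slots := v.slots + L * v.full }
      ⟨hv.1, hv.2, hv.3, hv.4, hv.5, hv.6⟩ hP hQ hb hc _ le_rfl,
      Nat.min_eq_right hv.numCands, hX, hY]
    simp only [run_clear, update_store_cand, hbad, hslots, Nat.zero_add]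
    by_cases hX0 : badCount I b d v v.numCands = 0
    · rw [run_ifz_pos (by exact hX0)]
      by_cases hY0 : L * v.full - totalCount I b d v v.numCands = 0
      · rw [run_ifz_pos (by exact hY0), if_pos (show Success I b d v from ⟨hle, hX0, hY0⟩)]
        simp only [run, update_store_answer, update_store_bad, update_store_slots,
          update_store_full, hc]
        rfl
      · rw [run_ifz_neg (by exact hY0), if_neg (show ¬ Success I b d v from fun h => hY0 h.2.2)]
        simp only [run, update_store_bad, update_store_slots, update_store_full, hc]
        rfl
    · rw [run_ifz_neg (by exact hX0), if_neg (show ¬ Success I b d v from fun h => hX0 h.2.1)]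
      simp only [run, update_store_bad, update_store_slots, update_store_full, hc]
      rfl

theorem iterate_fullBody (v : Vars) (hv : v.Bounded I.encode.length)
    (hP : v.targetScore = 0) (hQ : v.candScore = 0) (hb : v.bonus = 0) (hc : v.cand = 0)
    (hbad : v.bad = 0) (hslots : v.slots = 0) (hfull : v.full = 0) (n : ℕ)
    (hn : n ≤ I.encode.length) :
    ((fullBody L b d).run I.encode)^[n] v.store = { v with
      full := n
      answer := v.answer + ((Finset.range n).filter fun k =>
        Success I b d { v with full := k }).card }.store := by
  induction n with
  | zero =>
    have : ({ v with full := 0 } : Vars) = v := by cases v; simp_all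
    simp [this]
  | succ n ih =>
    rw [Function.iterate_succ_apply', ih (by omega), run_fullBody I b d
      { v with
        full := n
        answer := v.answer + ((Finset.range n).filter fun k =>
          Success I b d { v with full := k }).card } ⟨hv.1, hv.2, hv.3, hv.4, (by omega : n ≤ _), hv.6⟩ hP hQ hb hc hbad hslots]
    rw [Finset.range_add_one, Finset.filter_insert]
    dsimp only
    by_cases h : Success I b d { v with full := n }
    -- `Success` does not read `answer`, so the two conditions agree definitionally.
    · have h' : Success I b d { v with full := n, answer := v.answer + ((Finset.range n).filter
        fun k => Success I b d { v with full := k }).card } := h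
      rw [if_pos h, if_pos h', Finset.card_insert_of_notMem (by simp), Nat.add_assoc]
    · have h' : ¬ Success I b d { v with full := n, answer := v.answer + ((Finset.range n).filter
        fun k => Success I b d { v with full := k }).card } := h
      rw [if_neg h, if_neg h']
      rfl

/-! ### Reading the input, and conclusion -/

/-- The contents of the main registers after reading the input. -/
def parsed : Vars := ⟨I.numCandidates, I.numAbsent, I.target, 0, 0, 0, 0, 0, 0, 0, 0⟩

theorem run_parse : parse.run I.encode 0 = I.parsed.store := by
  unfold parse run
  generalize hf : (fun (s : Reg → ℕ) (x : Γ') => _) = f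
  -- After three commas all flags are set, and the encoded votes change nothing.
  have hskip : ∀ (u : List Γ') (s : Reg → ℕ), s .field₁ = 1 → s .field₂ = 1 → s .field₃ = 1 →
      u.foldl f s = s := by
    intro u s h1 h2 h3
    induction u with
    | nil => rfl
    | cons x u ih =>
      rw [List.foldl_cons]
      convert ih using 2
      subst hf
      rcases x with _ | _ | _ | _ | _ <;> simp [run, h1, h2, h3]
  have h1 : ∀ n, (encodeUnary n).foldl f 0 = Function.update (0 : Reg → ℕ) .numCands n := by
    intro n
    induction n with
    | zero => simp [encodeUnary]
    | succ n ih =>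
      unfold encodeUnary at ih ⊢
      rw [List.replicate_succ', List.foldl_append, ih]
      subst hf
      simp [run]
  have h2 : ∀ n s, s .field₁ = 1 → s .field₂ = 0 →
      (encodeUnary n).foldl f s = Function.update s .absent (s .absent + n) := by
    intro n s hs1 hs2
    induction n with
    | zero => simp [encodeUnary]
    | succ n ih =>
      unfold encodeUnary at ih ⊢
      rw [List.replicate_succ', List.foldl_append, ih]
      subst hf
      simp [run, hs1, hs2, Nat.add_assoc]
  have h3 : ∀ n s, s .field₁ = 1 → s .field₂ = 1 → s .field₃ = 0 →
      (encodeUnary n).foldl f s = Function.update s .target (s .target + n) := by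
    intro n s hs1 hs2 hs3
    induction n with
    | zero => simp [encodeUnary]
    | succ n ih =>
      unfold encodeUnary at ih ⊢
      rw [List.replicate_succ', List.foldl_append, ih]
      subst hf
      simp [run, hs1, hs2, hs3, Nat.add_assoc]
  have c1 : ∀ s, s .field₁ = 0 → f s .comma = Function.update s .field₁ 1 := by
    intro s hs; subst hf; simp [run, hs]
  have c2 : ∀ s, s .field₁ = 1 → s .field₂ = 0 → f s .comma = Function.update s .field₂ 1 := by
    intro s hs hs'; subst hf; simp [run, hs, hs']
  have c3 : ∀ s, s .field₁ = 1 → s .field₂ = 1 → s .field₃ = 0 →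
      f s .comma = Function.update s .field₃ 1 := by
    intro s hs hs' hs''; subst hf; simp [run, hs, hs', hs'']
  rw [encode, List.foldl_append, List.foldl_cons, List.foldl_append, List.foldl_cons,
    List.foldl_append, List.foldl_cons, h1,
    c1 (Function.update 0 .numCands I.numCandidates) (by simp)]
  generalize hs : Function.update (Function.update (0 : Reg → ℕ) .numCands I.numCandidates)
    .field₁ 1 = s
  have hs1 : s .field₁ = 1 := by simp [← hs]
  have hs2 : s .field₂ = 0 := by simp [← hs]
  have hs3 : s .field₃ = 0 := by simp [← hs]
  rw [h2 _ s hs1 hs2]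
  rw [c2 (Function.update s .absent _) (by simpa using hs1) (by simpa using hs2)]
  rw [h3 _ _ (by simpa using hs1) (by simp) (by simpa using hs3)]
  rw [c3 _ (by simpa using hs1) (by simp) (by simpa using hs3)]
  rw [hskip _ _ (by simpa using hs1) (by simp) (by simp)]
  subst hs
  funext r
  cases r <;> simp [parsed, store]

theorem parsed_bounded : I.parsed.Bounded I.encode.length := by
  have h := I.target.2
  constructor <;> simp [parsed, encode, encodeUnary] <;> omega

theorem run_program :
    (program L b d).run I.encode 0 .answer ≠ 0 ↔
      Feasible L b d (I.knownScore b d) I.numCandidates I.target I.numAbsent := by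
  -- The outer loop tries each k below the length of the word; the separating commas make this
  -- length exceed `numAbsent`, so no k ≤ t is missed.
  have habs : I.numAbsent < I.encode.length := by
    simp [encode, encodeUnary]; omega
  unfold program
  rw [run, run_parse, run_loop, iterate_fullBody I b d _ I.parsed_bounded rfl rfl rfl rfl rfl rfl rfl
    _ le_rfl]
  change 0 + Finset.card _ ≠ 0 ↔ _
  rw [Nat.zero_add, Finset.card_ne_zero, Finset.Nonempty]
  refine exists_congr fun k => ?_
  rw [Finset.mem_filter, Finset.mem_range, Success]
  have hbad : badCount I b d { I.parsed with full := k } I.numCandidates = 0 ↔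
      ∀ y < I.numCandidates, Fits b d (I.knownScore b d) I.target I.numAbsent k y 0 := by
    rw [badCount, Finset.card_eq_zero, Finset.filter_eq_empty_iff]
    simp [parsed]
  have htotal : totalCount I b d { I.parsed with full := k } I.numCandidates =
      ∑ y ∈ Finset.range I.numCandidates, ((Finset.range k).filter fun j =>
        Fits b d (I.knownScore b d) I.target I.numAbsent k y (j + 1)).card := rfl
  change _ ∧ k ≤ I.numAbsent ∧ badCount I b d { I.parsed with full := k } I.numCandidates = 0 ∧
    L * k - totalCount I b d { I.parsed with full := k } I.numCandidates = 0 ↔ _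
  rw [hbad, htotal, Nat.sub_eq_zero_iff_le, Nat.mul_comm]
  constructor
  · exact fun h => h.2
  · exact fun h => ⟨h.1.trans_lt habs, h⟩

end Main

end WAVInstance

theorem theorem8 (L : ℕ) (hL : 2 ≤ L) (a : Fin L → ℕ) (ha : Antitone a)
    (hflat : ∀ i j : Fin L, 1 ≤ i.val → 1 ≤ j.val → a i = a j) :
    DecidableInPolyTime (WAVInstance.encode (L := L)) (WAVInstance.IsYes a) := by
  have : Inhabited Computability.Γ' := ⟨.blank⟩
  refine LoopProgram.decidableInPolyTime
    (WAVInstance.program L (a ⟨1, hL⟩) (a ⟨0, by omega⟩ - a ⟨1, hL⟩)) .answer _ _ fun I => ?_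
  rw [WAVInstance.run_program]
  exact ⟨WAVInstance.isYes_of_feasible hL a ha hflat I,
    WAVInstance.feasible_of_isYes hL a ha hflat I⟩
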